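/- For a positive integer $k$ and a group $G$ generated by finitely many elements of order $k$, let $d_k(G)$ denote the smallest cardinality of a generating set of $G$ in which all elements have order exactly $k$. Let $n \geq k \geq 3$ be natural numbers. Let $S_n$ and $A_n$ be the symmetric and the alternating group on $n$ points. (i) If $k$ is even, then $d_k(S_n)=2$. Moreover $d_k(A_n)=2$, unless $k\in\{n-1,n\}$ is a power of $2$ or $(n,k)=(6,6)$; in these exceptional cases $A_n$ is not generated by elements of order $k$. (ii) If $k$ is odd, then $d_k(A_n)=2$ when $n\neq 3$, and $d_3(A_3)=1$. -/

import Mathlib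

/-- The set of all cardinalities of finite generating sets of the group `G` in which every
element has order exactly `k`. It is empty if and only if `G` is not generated by finitely many
elements of order `k`. -/
def genCards (k : ℕ) (G : Type*) [Group G] : Set ℕ :=
  {m | ∃ s : Finset G, s.card = m ∧ (∀ g ∈ s, orderOf g = k) ∧
    Subgroup.closure (s : Set G) = ⊤}

/-- `HasOrderRank k G d` says that `G` is generated by finitely many elements of order `k` and
that `d` is the smallest cardinality of a generating set of `G` in which all elements have
order `k`; in symbols, `d_k(G)` is defined and `d_k(G) = d`. -/
def HasOrderRank (k : ℕ) (G : Type*) [Group G] (d : ℕ) : Prop :=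
  IsLeast (genCards k G) d

/-- The exceptional pairs for alternating groups: `k ∈ {n - 1, n}` is a power of `2`, or
`(n, k) = (6, 6)`. -/
def IsExceptional (n k : ℕ) : Prop :=
  ((k + 1 = n ∨ k = n) ∧ ∃ m : ℕ, k = 2 ^ m) ∨ (n = 6 ∧ k = 6)

section

open Equiv Equiv.Perm

/-! One generator never suffices in a noncommutative group. It is therefore enough to find two
permutations of order `k` and equal sign whose group contains the alternating group; sign -1 then
gives the symmetric group, sign 1 the alternating group.

Most pairs come from an involution `a` and an element `b` of order `k` with ⟨a, b⟩ transitive. If `a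
* b` is a cycle `t` of length r ∈ {2, 3} times a disjoint cycle of length prime to r, then a power
of `a * b` is `t`. The relation of being joined by a transposition (or a 3-cycle) of the group is an
invariant equivalence relation, and it is total once one class meets its images under both
generators. So ⟨a, b⟩ contains the alternating group. Since a² = 1, conjugation by `a` interchanges
`b` and `a * b * a⁻¹`, so these two generate a subgroup normalized by the alternating group; for n ≥
5 simplicity makes it contain that group (`alternatingGroup_le_closure_conj`).

Such pairs are assembled from small pieces (`Config`). The start is a rotation `b` with a = (0 r).
Further cycles of `b` are hung on fixed points of `a` (`attach`), which lengthens the big cycle of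
`a * b`; a loop between neighbouring points (`loop`) shortens it by one. The rest is arithmetic with
lengths, signs and free slots (`Reachable`). Overlapping `k`-cycles treat odd `k` with k + 2 ≤ n <
2k, and a few small cases are explicit.

In the exceptional cases the cycle type forces every element of order `k` to be odd. -/

/-- `a` and `b` are equal or lie on a common 3-cycle belonging to `G`. -/
def ThreeCycleRel {α : Type*} [DecidableEq α] (G : Subgroup (Perm α)) (a b : α) : Prop :=
  a = b ∨ ∃ c, a ≠ b ∧ b ≠ c ∧ a ≠ c ∧ swap a b * swap b c ∈ G

/-! ### Subgroups in which 3-cycles link all points -/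

section ThreeCycles

variable {α : Type*} [DecidableEq α] {G : Subgroup (Perm α)}

/-- For distinct points, `swap a b * swap b c` is the 3-cycle a → b → c → a, written (a b c) below.
-/
lemma conj_swap_mul_swap_mem {a b c : α} {g : Perm α} (hg : g ∈ G)
    (h : swap a b * swap b c ∈ G) : swap (g a) (g b) * swap (g b) (g c) ∈ G := by
  have : swap (g a) (g b) * swap (g b) (g c) = g * (swap a b * swap b c) * g⁻¹ := by
    simp only [swap_apply_apply]; group
  rw [this]
  exact G.mul_mem (G.mul_mem hg h) (G.inv_mem hg)

lemma swap_mul_swap_rotate {a b c : α} (hab : a ≠ b) (hac : a ≠ c) :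
    swap a b * swap b c = swap b c * swap c a := by
  have h := swap_apply_apply (swap b c) a c
  rw [swap_apply_of_ne_of_ne hab hac, swap_apply_right, swap_inv] at h
  rw [h, swap_comm c a]
  simp only [mul_assoc, swap_mul_self, mul_one]

lemma inv_swap_mul_swap {a b c : α} (hab : a ≠ b) (hbc : b ≠ c) (hac : a ≠ c) :
    (swap a b * swap b c)⁻¹ = swap b a * swap a c := by
  rw [mul_inv_rev, swap_inv, swap_inv, swap_mul_swap_rotate hab.symm hbc,
    swap_mul_swap_rotate hac hab, swap_comm c b, swap_comm b a]

lemma swap_mul_swap_mem_symm {a b c : α} (hab : a ≠ b) (hbc : b ≠ c) (hac : a ≠ c)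
    (h : swap a c * swap c b ∈ G) : swap a b * swap b c ∈ G := by
  rw [← swap_mul_swap_rotate hac.symm hbc.symm, ← inv_swap_mul_swap hac hbc.symm hab]
  exact G.inv_mem h

lemma threeCycleRel_symm {a b : α} (h : ThreeCycleRel G a b) : ThreeCycleRel G b a := by
  rcases h with rfl | ⟨c, hab, hbc, hac, h⟩
  · exact Or.inl rfl
  · refine Or.inr ⟨c, hab.symm, hac, hbc, ?_⟩
    rw [← inv_swap_mul_swap hab hbc hac]
    exact G.inv_mem h

/-- Conjugating (a b c) by (b d e) fixes `a` and moves `b` to `d`. This fails only if `a` is `d` or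
`e`; in the latter case (b d e) itself passes through `a` and `d`. -/
lemma threeCycleRel_trans {a b d : α} (h₁ : ThreeCycleRel G a b) (h₂ : ThreeCycleRel G b d) :
    ThreeCycleRel G a d := by
  rcases h₁ with rfl | ⟨c, hab, hbc, hac, h⟩
  · exact h₂
  rcases h₂ with rfl | ⟨e, hbd, hde, hbe, h'⟩
  · exact Or.inr ⟨c, hab, hbc, hac, h⟩
  by_cases had : a = d
  · exact Or.inl had
  by_cases hae : a = e
  · subst hae
    refine Or.inr ⟨b, had, hbd.symm, hab, ?_⟩
    rw [← inv_swap_mul_swap (Ne.symm had) hab hbd.symm]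
    refine G.inv_mem ?_
    rwa [← swap_mul_swap_rotate hbd hbe]
  · have key := conj_swap_mul_swap_mem h' h
    have ha : (swap b d * swap d e) a = a := by
      rw [mul_apply, swap_apply_of_ne_of_ne had hae, swap_apply_of_ne_of_ne hab had]
    have hb : (swap b d * swap d e) b = d := by
      rw [mul_apply, swap_apply_of_ne_of_ne hbd hbe, swap_apply_left]
    rw [ha, hb] at key
    refine Or.inr ⟨_, had, ?_, ?_, key⟩
    · have := (swap b d * swap d e).injective.ne hbc
      rwa [hb] at this
    · have := (swap b d * swap d e).injective.ne hac
      rwa [ha] at this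

lemma threeCycleRel_map {a b : α} {g : Perm α} (hg : g ∈ G) (h : ThreeCycleRel G a b) :
    ThreeCycleRel G (g a) (g b) := by
  rcases h with rfl | ⟨c, hab, hbc, hac, h⟩
  · exact Or.inl rfl
  · exact Or.inr ⟨g c, (Equiv.injective _).ne hab, (Equiv.injective _).ne hbc,
      (Equiv.injective _).ne hac, conj_swap_mul_swap_mem hg h⟩

/-- If all pairs of points lie on 3-cycles of `G`, then all 3-cycles belong to `G`. -/
lemma swap_mul_swap_mem_of_forall_rel (hG : ∀ a b, ThreeCycleRel G a b) {a b c : α}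
    (hab : a ≠ b) (hbc : b ≠ c) (hac : a ≠ c) : swap a b * swap b c ∈ G := by
  obtain h | ⟨d, -, hbd, had, h⟩ := hG a b
  · exact absurd h hab
  by_cases hdc : d = c
  · exact hdc ▸ h
  obtain h' | ⟨e, -, hce, hde, h'⟩ := hG d c
  · exact absurd h' hdc
  have hd : (swap d c * swap c e) d = c := by
    rw [mul_apply, swap_apply_of_ne_of_ne hdc hde, swap_apply_left]
  have hc : (swap d c * swap c e) c = e := by
    rw [mul_apply, swap_apply_left, swap_apply_of_ne_of_ne hde.symm hce.symm]
  have he : (swap d c * swap c e) e = d := by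
    rw [mul_apply, swap_apply_right, swap_apply_right]
  have fix : ∀ x, x ≠ d → x ≠ c → x ≠ e → (swap d c * swap c e) x = x := by
    intro x h1 h2 h3
    rw [mul_apply, swap_apply_of_ne_of_ne h2 h3, swap_apply_of_ne_of_ne h1 h2]
  -- Conjugation by (d c e) turns (a b d) into (a b c), unless `e` is `a` or `b`. If e = a it gives
  -- (d b c); if e = b, applying it twice gives (a c b).
  have key := conj_swap_mul_swap_mem h' h
  rw [hd] at key
  -- a 3-cycle of the form `(d b c)` in `G` suffices
  have fin : swap d b * swap b c ∈ G → swap a b * swap b c ∈ G := by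
    intro hr
    have h1 : (swap d b * swap b c) a = a := by
      rw [mul_apply, swap_apply_of_ne_of_ne hab hac, swap_apply_of_ne_of_ne had hab]
    have h2 : (swap d b * swap b c) b = c := by
      rw [mul_apply, swap_apply_left, swap_apply_of_ne_of_ne (Ne.symm hdc) hbc.symm]
    have h3 : (swap d b * swap b c) d = b := by
      rw [mul_apply, swap_apply_of_ne_of_ne hbd.symm hdc, swap_apply_left]
    have k := conj_swap_mul_swap_mem hr h
    rw [h1, h2, h3] at k
    exact swap_mul_swap_mem_symm hab hbc hac k
  by_cases hea : e = a
  · subst hea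
    refine fin ?_
    have k := conj_swap_mul_swap_mem h' h
    rw [he, hd, fix b hbd hbc hab.symm] at k
    exact k
  by_cases heb : e = b
  · subst heb
    have k := conj_swap_mul_swap_mem h' h
    rw [he, hd, fix a had hac hab] at k
    have k2 := conj_swap_mul_swap_mem h' k
    rw [hd, hc, fix a had hac hab] at k2
    exact swap_mul_swap_mem_symm hab hbc hac k2
  · rwa [fix a had hac (Ne.symm hea), fix b hbd hbc (Ne.symm heb)] at key

/-- Two points of the support of a 3-cycle of `G` are related. -/
lemma threeCycleRel_of_mem_support [Fintype α] {t : Perm α} (ht : t.IsThreeCycle) (htG : t ∈ G)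
    {a b : α} (ha : a ∈ t.support) (hb : b ∈ t.support) : ThreeCycleRel G a b := by
  have key : ∀ a ∈ t.support, ThreeCycleRel G a (t a) := by
    intro a ha
    have h := ht.eq_swap_mul_swap_iff_mem_support.2 ha
    have hn := ht.nodup_iff_mem_support.2 ha
    simp only [List.nodup_cons, List.mem_cons, List.not_mem_nil, or_false, not_or] at hn
    exact Or.inr ⟨t (t a), hn.1.1, hn.2.1, hn.1.2, h ▸ htG⟩
  rw [ht.support_eq_iff_mem_support.2 ha] at hb
  have h1 := key a ha
  have h2 := key (t a) (apply_mem_support.2 ha)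
  simp only [Finset.mem_insert, Finset.mem_singleton] at hb
  rcases hb with rfl | rfl | rfl
  · exact Or.inl rfl
  · exact h1
  · exact threeCycleRel_trans h1 h2

lemma alternatingGroup_le_of_forall_rel [Fintype α] (hG : ∀ a b, ThreeCycleRel G a b) :
    alternatingGroup α ≤ G := by
  rw [← closure_three_cycles_eq_alternating, Subgroup.closure_le]
  intro t ht
  obtain ⟨a, ha⟩ : t.support.Nonempty := by
    rw [← Finset.card_pos, IsThreeCycle.card_support ht]; norm_num
  have h := (IsThreeCycle.eq_swap_mul_swap_iff_mem_support ht).2 ha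
  have hn := (IsThreeCycle.nodup_iff_mem_support ht).2 ha
  simp only [List.nodup_cons, List.mem_cons, List.not_mem_nil, or_false, not_or] at hn
  rw [SetLike.mem_coe, h]
  exact swap_mul_swap_mem_of_forall_rel hG hn.1.1 hn.2.1 hn.1.2

end ThreeCycles

/-! ### Transitive pairs and Jordan-type criteria -/

section Generation

variable {α : Type*} {x y : Perm α}

/-- The group generated by `x` and `y` is transitive: a nonempty set of points that is mapped to
itself by both is everything. -/
def TransitivePair (x y : Perm α) : Prop :=
  ∀ B : Set α, B.Nonempty → (∀ u ∈ B, x u ∈ B) → (∀ u ∈ B, y u ∈ B) → B = Set.univ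

/-- An invariant equivalence relation is total if it has a class meeting its images under both
generators of a transitive group. -/
lemma forall_rel_of_transitivePair (hxy : TransitivePair x y) {R : α → α → Prop}
    (hR : Equivalence R) (hx : ∀ u v, R u v → R (x u) (x v)) (hy : ∀ u v, R u v → R (y u) (y v))
    {z w : α} (hz : R z (x z)) (hzw : R z w) (hw : R w (y w)) (a b : α) : R a b := by
  -- The class of `z` contains `x z`, `w` and `y w`, so by invariance both generators map it into
  -- itself.
  have h := hxy {u | R z u} ⟨z, hR.refl z⟩ (fun u hu => hR.trans hz (hx _ _ hu))
    (fun u hu => hR.trans hzw (hR.trans hw (hy _ _ (hR.trans (hR.symm hzw) hu))))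
  have ha : a ∈ {u | R z u} := h ▸ Set.mem_univ a
  have hb : b ∈ {u | R z u} := h ▸ Set.mem_univ b
  exact hR.trans (hR.symm ha) hb

variable [DecidableEq α] [Fintype α]

/-- Two points of `t` are related, so the conditions on `z` and `w` say that the class of `t` meets
its images under `x` and `y`. -/
theorem alternatingGroup_le_closure_pair (hxy : TransitivePair x y) {t : Perm α}
    (ht : t.IsThreeCycle) (htG : t ∈ Subgroup.closure {x, y}) {z w : α}
    (hz : z ∈ t.support) (hxz : x z ∈ t.support) (hw : w ∈ t.support) (hyw : y w ∈ t.support) :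
    alternatingGroup α ≤ Subgroup.closure {x, y} := by
  refine alternatingGroup_le_of_forall_rel (forall_rel_of_transitivePair hxy
    ⟨fun _ => Or.inl rfl, threeCycleRel_symm, threeCycleRel_trans⟩
    (fun u v h => threeCycleRel_map (Subgroup.subset_closure (by simp)) h)
    (fun u v h => threeCycleRel_map (Subgroup.subset_closure (by simp)) h)
    (threeCycleRel_of_mem_support ht htG hz hxz) (threeCycleRel_of_mem_support ht htG hz hw)
    (threeCycleRel_of_mem_support ht htG hw hyw))

/-- The same argument, with the relation `swap u v ∈ closure {x, y}`. -/
theorem closure_pair_eq_top (hxy : TransitivePair x y) {t : Perm α}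
    (ht : t.IsSwap) (htG : t ∈ Subgroup.closure {x, y}) {z w : α}
    (hz : z ∈ t.support) (hxz : x z ∈ t.support) (hw : w ∈ t.support) (hyw : y w ∈ t.support) :
    Subgroup.closure {x, y} = ⊤ := by
  have hmem : ∀ a ∈ t.support, ∀ b ∈ t.support, swap a b ∈ Subgroup.closure {x, y} := by
    obtain ⟨p, q, hpq, rfl⟩ := ht
    intro a ha b hb
    simp only [support_swap hpq, Finset.mem_insert, Finset.mem_singleton] at ha hb
    rcases ha with rfl | rfl <;> rcases hb with rfl | rfl
    · rw [swap_self]; exact one_mem _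
    · exact htG
    · rwa [swap_comm]
    · rw [swap_self]; exact one_mem _
  have hmap : ∀ g ∈ Subgroup.closure {x, y}, ∀ u v, swap u v ∈ Subgroup.closure {x, y} →
      swap (g u) (g v) ∈ Subgroup.closure {x, y} := by
    intro g hg u v h
    rw [swap_apply_apply]
    exact mul_mem (mul_mem hg h) (inv_mem hg)
  have key := forall_rel_of_transitivePair (R := fun u v => swap u v ∈ Subgroup.closure {x, y}) hxy
    ⟨fun a => by rw [swap_self]; exact one_mem _, fun h => by rwa [swap_comm],
      fun h h' => SubmonoidClass.swap_mem_trans _ h h'⟩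
    (hmap x (Subgroup.subset_closure (by simp))) (hmap y (Subgroup.subset_closure (by simp)))
    (hmem z hz _ hxz) (hmem z hz w hw) (hmem w hw _ hyw)
  rw [eq_top_iff, ← closure_isSwap, Subgroup.closure_le]
  rintro _ ⟨a, b, -, rfl⟩
  exact key a b

end Generation

/-! ### Joining and cutting cycles by a transposition -/

section Cyclic

variable {α : Type*} {f : Perm α} {S T : Finset α}

/-- `f` maps `S` to itself and permutes it cyclically. -/
def CyclicOn (f : Perm α) (S : Finset α) : Prop :=
  (∀ u ∈ S, f u ∈ S) ∧ ∀ u ∈ S, ∀ v ∈ S, ∃ i : ℕ, (f ^ i) u = v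

lemma CyclicOn.isCycleOn (h : CyclicOn f S) : f.IsCycleOn (S : Set α) := by
  refine ⟨⟨fun u hu => h.1 u hu, f.injective.injOn, fun v hv => ?_⟩, fun u hu v hv => ?_⟩
  · obtain ⟨i, hi⟩ := h.2 _ (h.1 v hv) v hv
    rcases i with _ | i
    · exact ⟨v, hv, hi⟩
    · have hmem : ∀ j : ℕ, (f ^ j) (f v) ∈ S := by
        intro j
        induction j with
        | zero => exact h.1 v hv
        | succ j ih => rw [pow_succ', mul_apply]; exact h.1 _ ih
      exact ⟨(f ^ i) (f v), hmem i, by rw [← mul_apply, ← pow_succ']; exact hi⟩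
  · obtain ⟨i, hi⟩ := h.2 u hu v hv
    exact ⟨i, by simpa using hi⟩

lemma exists_pow_trans {u v w : α} (h₁ : ∃ i : ℕ, (f ^ i) u = v) (h₂ : ∃ i : ℕ, (f ^ i) v = w) :
    ∃ i : ℕ, (f ^ i) u = w := by
  obtain ⟨i, rfl⟩ := h₁
  obtain ⟨j, rfl⟩ := h₂
  exact ⟨j + i, by rw [pow_add, mul_apply]⟩

lemma exists_pow_symm [Finite α] {u v : α} (h : ∃ i : ℕ, (f ^ i) u = v) :
    ∃ i : ℕ, (f ^ i) v = u := by
  obtain ⟨i, hi⟩ := h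
  have : SameCycle f u v := ⟨i, by simpa using hi⟩
  exact this.symm.exists_nat_pow_eq

variable [DecidableEq α]

/-- Multiplying by a transposition joins two cycles. -/
lemma CyclicOn.swap_mul [Finite α] (hS : CyclicOn f S) (hT : CyclicOn f T) (hST : Disjoint S T) {z w : α}
    (hz : z ∈ S) (hw : w ∈ T) : CyclicOn (swap z w * f) (S ∪ T) := by
  have aux : ∀ (S T : Finset α) (z w : α), CyclicOn f S → Disjoint S T → z ∈ S → w ∈ T →
      ∀ u ∈ S, ∃ i : ℕ, ((swap z w * f) ^ i) u = w := by
    intro S T z w hS hST hz hw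
    -- The product follows `f` until the orbit enters `z`, where it is diverted to `w`. The exponent
    -- is positive because the diversion happens on entering `z`, not on starting there.
    have key : ∀ (i : ℕ) (u : α), u ∈ S → (f ^ (i + 1)) u = z →
        ∃ j : ℕ, ((swap z w * f) ^ j) u = w := by
      intro i
      induction i with
      | zero =>
        intro u _ h
        refine ⟨1, ?_⟩
        rw [zero_add, pow_one] at h
        rw [pow_one, mul_apply, h, swap_apply_left]
      | succ i ih =>
        intro u hu h
        by_cases hfu : f u = z
        · exact ⟨1, by rw [pow_one, mul_apply, hfu, swap_apply_left]⟩
        · have hne : f u ≠ w := fun e =>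
            (Finset.disjoint_left.1 hST (hS.1 u hu)) (e ▸ hw)
          rw [pow_succ, mul_apply] at h
          refine exists_pow_trans ⟨1, ?_⟩ (ih (f u) (hS.1 u hu) h)
          rw [pow_one, mul_apply, swap_apply_of_ne_of_ne hfu hne]
    intro u hu
    obtain ⟨i, hi⟩ := hS.2 (f u) (hS.1 u hu) z hz
    exact key i u hu (by rw [pow_succ, mul_apply]; exact hi)
  have h1 := aux S T z w hS hST hz hw
  have h2 := aux T S w z hT hST.symm hw hz
  rw [swap_comm w z] at h2
  have hzw := h1 z hz
  have hwz := h2 w hw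
  -- every point reaches `w`
  have toW : ∀ u ∈ S ∪ T, ∃ i : ℕ, ((swap z w * f) ^ i) u = w := by
    intro u hu
    rcases Finset.mem_union.1 hu with hu | hu
    · exact h1 u hu
    · exact exists_pow_trans (h2 u hu) hzw
  have hmap : ∀ u ∈ S ∪ T, (swap z w * f) u ∈ S ∪ T := by
    intro u hu
    have : f u ∈ S ∪ T := by
      rcases Finset.mem_union.1 hu with hu | hu
      · exact Finset.mem_union_left _ (hS.1 u hu)
      · exact Finset.mem_union_right _ (hT.1 u hu)
    rw [mul_apply, swap_apply_def]
    split_ifs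
    · exact Finset.mem_union_right _ hw
    · exact Finset.mem_union_left _ hz
    · exact this
  refine ⟨hmap, fun u hu v hv => exists_pow_trans (toW u hu)
    (exists_pow_symm (toW v hv))⟩

/-- Cutting a point out of a cycle. -/
lemma CyclicOn.swap_mul_erase (hS : CyclicOn f S) {u : α} (hu : u ∈ S) (hfu : f u ≠ u) :
    CyclicOn (swap u (f u) * f) (S.erase u) := by
  have hval : ∀ v, v ≠ u → f v ≠ u → (swap u (f u) * f) v = f v := by
    intro v hv h
    rw [mul_apply, swap_apply_of_ne_of_ne h (f.injective.ne hv)]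
  have hval' : ∀ v, f v = u → (swap u (f u) * f) v = f u := by
    intro v h
    rw [mul_apply, h, swap_apply_left]
  refine ⟨fun v hv => ?_, fun v hv w hw => ?_⟩
  · rw [Finset.mem_erase] at hv ⊢
    by_cases h : f v = u
    · rw [hval' v h]
      exact ⟨hfu, hS.1 u hu⟩
    · rw [hval v hv.1 h]
      exact ⟨h, hS.1 v hv.2⟩
  -- The bound `n` allows strong induction: the passage v → u → f u takes two steps of `f` but only
  -- one of the new permutation.
  · have key : ∀ (n i : ℕ) (v : α), i ≤ n → v ≠ u → (f ^ i) v = w →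
        ∃ j : ℕ, ((swap u (f u) * f) ^ j) v = w := by
      intro n
      induction n with
      | zero =>
        intro i v hi _ h
        obtain rfl : i = 0 := by omega
        exact ⟨0, h⟩
      | succ n ih =>
        intro i v hi hv h
        rcases i with _ | i
        · exact ⟨0, h⟩
        rw [pow_succ, mul_apply] at h
        by_cases hfv : f v = u
        · rcases i with _ | i
          · exact absurd (h.symm.trans hfv) (Finset.mem_erase.1 hw).1
          rw [hfv, pow_succ, mul_apply] at h
          exact exists_pow_trans ⟨1, by rw [pow_one, hval' v hfv]⟩ (ih i (f u) (by omega) hfu h)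
        · exact exists_pow_trans ⟨1, by rw [pow_one, hval v hv hfv]⟩
            (ih i (f v) (by omega) hfv h)
    obtain ⟨i, hi⟩ := hS.2 v (Finset.mem_of_mem_erase hv) w (Finset.mem_of_mem_erase hw)
    exact key i i v le_rfl (Finset.mem_erase.1 hv).1 hi

end Cyclic

lemma cyclicOn_of_succ {n r : ℕ} (hr : r < n) {f : Perm (Fin n)}
    (hsucc : ∀ u : Fin n, r ≤ u → ∀ h : (u : ℕ) + 1 < n, f u = ⟨u + 1, h⟩)
    (hlast : ∀ u : Fin n, (u : ℕ) + 1 = n → f u = ⟨r, hr⟩) :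
    CyclicOn f (Finset.univ.filter fun u : Fin n => r ≤ u) := by
  have up : ∀ (i : ℕ) (u v : Fin n), r ≤ u → (u : ℕ) + i = v → (f ^ i) u = v := by
    intro i
    induction i with
    | zero => intro u v _ h; exact Fin.ext (by simpa using h)
    | succ i ih =>
      intro u v hu h
      rw [pow_succ, mul_apply, hsucc u hu (by omega)]
      exact ih _ _ (by simp only; omega) (by simp only; omega)
  simp only [CyclicOn, Finset.mem_filter, Finset.mem_univ, true_and]
  refine ⟨fun u hu => ?_, fun u hu v hv => ?_⟩
  · by_cases h : (u : ℕ) + 1 < n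
    · rw [hsucc u hu h]; simp only; omega
    · rw [hlast u (by omega)]
  · have h1 : (f ^ (n - 1 - u)) u = ⟨n - 1, by omega⟩ := up _ _ _ hu (by simp only; omega)
    have h2 : (f ^ 1) ⟨n - 1, by omega⟩ = ⟨r, hr⟩ := by
      rw [pow_one]; exact hlast _ (by simp only; omega)
    have h3 : (f ^ (v - r : ℕ)) ⟨r, hr⟩ = v := up _ _ _ le_rfl (by simp only; omega)
    exact exists_pow_trans (exists_pow_trans ⟨_, h1⟩ ⟨_, h2⟩) ⟨_, h3⟩

lemma finRotate_apply_of_lt {n : ℕ} (u : Fin n) (h : (u : ℕ) + 1 < n) :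
    finRotate n u = ⟨u + 1, h⟩ := by
  obtain ⟨m, rfl⟩ : ∃ m, n = m + 1 := ⟨n - 1, by omega⟩
  exact finRotate_of_lt (by omega)

lemma finRotate_apply_of_eq {n : ℕ} (u : Fin n) (h : (u : ℕ) + 1 = n) :
    finRotate n u = ⟨0, by omega⟩ := by
  obtain ⟨m, rfl⟩ : ∃ m, n = m + 1 := ⟨n - 1, by omega⟩
  have : u = Fin.last m := Fin.ext (by simp; omega)
  exact (congrArg _ this).trans finRotate_last

lemma cyclicOn_finRotate {n : ℕ} (hn : 0 < n) : CyclicOn (finRotate n) Finset.univ := by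
  have := cyclicOn_of_succ hn (f := finRotate n) (fun u _ h => finRotate_apply_of_lt u h)
    (fun u h => finRotate_apply_of_eq u h)
  simpa using this

lemma CyclicOn.mem_of_forall_mem {α : Type*} {f : Perm α} {S : Finset α} (h : CyclicOn f S)
    {B : Set α} (hB : ∀ u ∈ B, f u ∈ B) {u v : α} (hu : u ∈ S) (huB : u ∈ B) (hv : v ∈ S) :
    v ∈ B := by
  obtain ⟨i, rfl⟩ := h.2 u hu v hv
  clear hv
  induction i with
  | zero => exact huB
  | succ i ih => rw [pow_succ', mul_apply]; exact hB _ ih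

lemma orderOf_finRotate (i : ℕ) : orderOf (finRotate (i + 1)) = i + 1 := by
  rcases i with _ | i
  · rw [orderOf_eq_one_iff]; exact finRotate_one
  · rw [isCycle_finRotate.orderOf, support_finRotate]; simp

lemma orderOf_sumCongr {α β : Type*} (f : Perm α) (g : Perm β) :
    orderOf (Perm.sumCongr f g) = Nat.lcm (orderOf f) (orderOf g) := by
  have := orderOf_injective (sumCongrHom α β) sumCongrHom_injective (f, g)
  rw [Prod.orderOf] at this
  exact this

lemma support_sumCongr_one {α β : Type*} [Fintype α] [DecidableEq α] [Fintype β] [DecidableEq β]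
    (t : Perm α) : (Perm.sumCongr t (1 : Perm β)).support = t.support.map Function.Embedding.inl := by
  ext (u | u) <;> simp

/-! ### From an involution to a conjugate pair -/

section Normal

variable {α : Type*} [Fintype α] [DecidableEq α] {a b : Perm α}

/-- If an involution `a` and `b` generate a group containing the alternating group, then so do
`b` and its conjugate under `a`. -/
theorem alternatingGroup_le_closure_conj (h5 : 5 ≤ Nat.card α) (ha : a * a = 1)
    (hb : 3 ≤ orderOf b) (hab : alternatingGroup α ≤ Subgroup.closure {a, b}) :
    alternatingGroup α ≤ Subgroup.closure {b, a * b * a⁻¹} := by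
  set N := Subgroup.closure {b, a * b * a⁻¹} with hN
  have hbN : b ∈ N := Subgroup.subset_closure (by simp)
  have haN : a * b * a⁻¹ ∈ N := Subgroup.subset_closure (by simp)
  have ha' : a⁻¹ = a := inv_eq_of_mul_eq_one_right ha
  -- Since a² = 1, conjugation by `a` interchanges the two generators of `N`. As b ∈ N too, ⟨a, b⟩
  -- normalizes `N`.
  have hconj : ∀ n ∈ N, a * n * a⁻¹ ∈ N := by
    intro n hn
    have hle : N ≤ N.comap (MulAut.conj a).toMonoidHom := by
      rw [hN, Subgroup.closure_le]
      rintro g (rfl | rfl)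
      · exact haN
      · have : a * (a * b * a⁻¹) * a⁻¹ = b := by
          rw [ha', ← mul_assoc, ← mul_assoc, ha, one_mul, mul_assoc, ha, mul_one]
        simpa [this] using hbN
    exact hle hn
  have hnorm : Subgroup.closure {a, b} ≤ Subgroup.normalizer (N : Set (Perm α)) := by
    rw [Subgroup.closure_le]
    rintro g (rfl | rfl)
    · rw [SetLike.mem_coe, Subgroup.mem_normalizer_iff]
      refine fun n => ⟨hconj n, fun hn => ?_⟩
      have := hconj _ hn
      rw [ha'] at this
      simpa [mul_assoc, ha, ← mul_assoc g g n] using this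
    · exact Subgroup.le_normalizer hbN
  have hA := hab.trans hnorm
  have := alternatingGroup.isSimpleGroup h5
  have hn : (N.subgroupOf (alternatingGroup α)).Normal := by
    refine ⟨fun n hn g => ?_⟩
    exact (Subgroup.mem_normalizer_iff.1 (hA g.2) _).1 hn
  rcases hn.eq_bot_or_eq_top with h | h
  -- A trivial intersection would contain the even permutation b², against 3 ≤ orderOf b.
  · exfalso
    have h2 : (⟨b * b, by simp [mem_alternatingGroup, Int.units_mul_self]⟩ :
        alternatingGroup α) ∈ N.subgroupOf (alternatingGroup α) := N.mul_mem hbN hbN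
    rw [h, Subgroup.mem_bot, Subtype.ext_iff] at h2
    have := orderOf_le_of_pow_eq_one (n := 2) (x := b) (by norm_num) (by rw [pow_two]; exact h2)
    omega
  · exact Subgroup.subgroupOf_eq_top.1 h

end Normal

/-! ### Configurations and the operations on them -/

/-- An involution `a` and a permutation `b` generating a transitive group such that `a * b`
permutes `S` cyclically (by `d`), and is otherwise a cycle `t` of length `r` that meets the fixed
points of `a`. The set `Z` consists of fixed points of `a` in `S`: further cycles of `b` can be
attached there. -/
structure Config {α : Type*} [Fintype α] [DecidableEq α] (r : ℕ) (a b t d : Perm α)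
    (S Z : Finset α) : Prop where
  inv : a * a = 1
  prod : a * b = t * d
  card_support : t.support.card = r
  fix : ∀ u ∈ S, t u = u
  cyc : CyclicOn d S
  fix' : ∀ u ∉ S, d u = u
  sub : Z ⊆ S
  slots : ∀ u ∈ Z, a u = u
  exists_fixed : ∃ z ∈ t.support, a z = z
  trans : TransitivePair a b

namespace Config

variable {α : Type*} [Fintype α] [DecidableEq α] {r : ℕ} {a b t d : Perm α} {S Z : Finset α}

/-- `t` and `d` are disjoint and d has order dividing |S|, so the |S|-th power of `a * b` is a power
of `t` alone, and coprimality recovers `t`. -/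
lemma mem_closure (h : Config r a b t d S Z) (ht : orderOf t = r) (hr : r.Coprime S.card) :
    t ∈ Subgroup.closure {a, a * b} := by
  have hdisj : Disjoint t d := fun u => by
    by_cases hu : u ∈ S
    · exact Or.inl (h.fix u hu)
    · exact Or.inr (h.fix' u hu)
  have hd : d ^ S.card = 1 := by
    ext u
    by_cases hu : u ∈ S
    · exact h.cyc.isCycleOn.pow_card_apply hu
    · rw [pow_apply_eq_self_of_apply_eq_self (h.fix' u hu)]; rfl
  have hpow : (a * b) ^ S.card = t ^ S.card := by
    rw [h.prod, hdisj.commute.mul_pow, hd, mul_one]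
  obtain ⟨m, hm⟩ := exists_pow_eq_self_of_coprime (x := t) (n := S.card) (by rw [ht]; exact hr.symm)
  rw [← hm, ← hpow]
  exact Subgroup.pow_mem _ (Subgroup.pow_mem _ (Subgroup.subset_closure (by simp)) _) _

/-- The fixed point `z` of `a` on `t` serves both generators `a` and `a * b`: the first fixes it,
and the second acts on it as `t`, because z ∉ S. -/
lemma alternatingGroup_le (h : Config r a b t d S Z) (hr : r = 2 ∨ r = 3)
    (hS : r.Coprime S.card) : alternatingGroup α ≤ Subgroup.closure {a, b} := by
  have hcl : Subgroup.closure {a, a * b} ≤ Subgroup.closure {a, b} := by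
    rw [Subgroup.closure_le]
    rintro g (rfl | rfl)
    · exact Subgroup.subset_closure (by simp)
    · exact Subgroup.mul_mem _ (Subgroup.subset_closure (by simp))
        (Subgroup.subset_closure (by simp))
  have haa : ∀ u, a (a u) = u := fun u => by rw [← mul_apply, h.inv, one_apply]
  have htr : TransitivePair a (a * b) := fun B hB h1 h2 =>
    h.trans B hB h1 fun u hu => by simpa [haa] using h1 _ (h2 u hu)
  obtain ⟨z, hz, haz⟩ := h.exists_fixed
  have hzS : z ∉ S := fun hzS => (mem_support.1 hz) (h.fix z hzS)
  have hcz : (a * b) z ∈ t.support := by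
    rw [h.prod, mul_apply, h.fix' z hzS]
    exact apply_mem_support.2 hz
  refine le_trans ?_ hcl
  rcases hr with rfl | rfl
  · have ht : t.IsSwap := card_support_eq_two.1 h.card_support
    rw [closure_pair_eq_top htr ht (h.mem_closure ht.orderOf hS) hz (haz.symm ▸ hz) hz hcz]
    exact le_top
  · have ht : t.IsThreeCycle := card_support_eq_three_iff.1 h.card_support
    exact alternatingGroup_le_closure_pair htr ht (h.mem_closure ht.orderOf hS) hz
      (haz.symm ▸ hz) hz hcz

/-- Joining two consecutive slots of `b`. -/
lemma loop (h : Config r a b t d S Z) {u : α} (hu : u ∈ Z) (hbu : b u ∈ Z) (hne : b u ≠ u) :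
    Config r (swap u (b u) * a) b t (swap u (b u) * d) (S.erase u) ((Z.erase u).erase (b u)) := by
  have hau := h.slots u hu
  have habu := h.slots _ hbu
  have hcomm : swap u (b u) * a = a * swap u (b u) := by
    rw [mul_swap_eq_swap_mul, hau, habu]
  -- `t` is trivial on `S` and `a` fixes `b u`, so `b u` follows `u` on the large cycle; the new
  -- transposition cuts `u` out.
  have hdu : d u = b u := by
    have : (a * b) u = t (d u) := by rw [h.prod]; rfl
    rw [h.fix _ (h.cyc.1 u (h.sub hu)), mul_apply, habu] at this
    exact this.symm
  have htc : swap u (b u) * t = t * swap u (b u) := by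
    rw [mul_swap_eq_swap_mul, h.fix u (h.sub hu), h.fix _ (h.sub hbu)]
  have hval : ∀ v, v ≠ u → v ≠ b u → (swap u (b u) * a) v = a v := by
    intro v h1 h2
    rw [hcomm, mul_apply, swap_apply_of_ne_of_ne h1 h2]
  refine ⟨?_, ?_, h.card_support, fun v hv => h.fix v (Finset.mem_of_mem_erase hv), ?_, ?_, ?_,
    ?_, ?_, ?_⟩
  · nth_rewrite 2 [hcomm]
    rw [mul_assoc, ← mul_assoc a a, h.inv, one_mul, swap_mul_self]
  · rw [mul_assoc, h.prod, ← mul_assoc, htc, mul_assoc]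
  · rw [← hdu]
    exact h.cyc.swap_mul_erase (h.sub hu) (hdu ▸ hne)
  · intro v hv
    rw [Finset.mem_erase, not_and] at hv
    by_cases hvu : v = u
    · rw [hvu, mul_apply, hdu, swap_apply_right]
    · have hvS := hv hvu
      rw [mul_apply, h.fix' v hvS, swap_apply_of_ne_of_ne hvu]
      rintro rfl
      exact hvS (h.sub hbu)
  · intro v hv
    simp only [Finset.mem_erase] at hv ⊢
    exact ⟨hv.2.1, h.sub hv.2.2⟩
  · intro v hv
    simp only [Finset.mem_erase] at hv
    rw [hval v hv.2.1 hv.1, h.slots v hv.2.2]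
  · obtain ⟨z, hz, haz⟩ := h.exists_fixed
    have hzS : z ∉ S := fun hzS => (mem_support.1 hz) (h.fix z hzS)
    refine ⟨z, hz, ?_⟩
    rw [hval z, haz]
    · rintro rfl; exact hzS (h.sub hu)
    · rintro rfl; exact hzS (h.sub hbu)
  · intro B hB h1 h2
    -- The old `a` agrees with the new one away from `u` and `b u`, and fixes these two points.
    refine h.trans B hB (fun v hv => ?_) h2
    by_cases hvu : v = u
    · rwa [hvu, hau, ← hvu]
    by_cases hvb : v = b u
    · rwa [hvb, habu, ← hvb]
    rw [← hval v hvu hvb]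
    exact h1 v hv

/-- Attaching a further cycle of `b` at a slot `z`. -/
lemma attach (h : Config r a b t d S Z) {z : α} (hz : z ∈ Z) (i : ℕ) :
    Config r (swap (Sum.inl z) (Sum.inr 0) * Perm.sumCongr a (1 : Perm (Fin (i + 1))))
      (Perm.sumCongr b (finRotate (i + 1))) (Perm.sumCongr t 1)
      (swap (Sum.inl z) (Sum.inr 0) * Perm.sumCongr d (finRotate (i + 1)))
      (S.disjSum Finset.univ) ((Z.erase z).disjSum (Finset.univ.erase 0)) := by
  have haz := h.slots z hz
  have htz := h.fix z (h.sub hz)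
  -- Both ends of the new transposition are fixed by the old `a` and by `t`. It therefore commutes
  -- with them, and in the product it acts only to join the cycle of `d` to the new cycle.
  have hcomm : swap (Sum.inl z) (Sum.inr 0) * Perm.sumCongr a (1 : Perm (Fin (i + 1))) =
      Perm.sumCongr a (1 : Perm (Fin (i + 1))) * swap (Sum.inl z) (Sum.inr 0) := by
    rw [mul_swap_eq_swap_mul]; simp [haz]
  have htc : swap (Sum.inl z) (Sum.inr 0) * Perm.sumCongr t (1 : Perm (Fin (i + 1))) =
      Perm.sumCongr t (1 : Perm (Fin (i + 1))) * swap (Sum.inl z) (Sum.inr 0) := by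
    rw [mul_swap_eq_swap_mul]; simp [htz]
  have hval : ∀ v, v ≠ z → (swap (Sum.inl z) (Sum.inr 0) *
      Perm.sumCongr a 1 : Perm (α ⊕ Fin (i + 1))) (Sum.inl v) = Sum.inl (a v) := by
    intro v hv
    rw [hcomm, mul_apply, swap_apply_of_ne_of_ne (by simpa using hv) (by simp)]
    simp
  have hval' : ∀ v : Fin (i + 1), v ≠ 0 → (swap (Sum.inl z) (Sum.inr 0) *
      Perm.sumCongr a 1 : Perm (α ⊕ Fin (i + 1))) (Sum.inr v) = Sum.inr v := by
    intro v hv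
    rw [hcomm, mul_apply, swap_apply_of_ne_of_ne (by simp) (by simpa using hv)]
    simp
  have hvz : (swap (Sum.inl z) (Sum.inr 0) *
      Perm.sumCongr a 1 : Perm (α ⊕ Fin (i + 1))) (Sum.inl z) = Sum.inr 0 := by
    rw [hcomm, mul_apply, swap_apply_left]; simp
  have hv0 : (swap (Sum.inl z) (Sum.inr 0) *
      Perm.sumCongr a 1 : Perm (α ⊕ Fin (i + 1))) (Sum.inr 0) = Sum.inl z := by
    rw [hcomm, mul_apply, swap_apply_right]; simp [haz]
  have hcyc : CyclicOn (swap (Sum.inl z) (Sum.inr 0) * Perm.sumCongr d (finRotate (i + 1)))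
      (S.disjSum Finset.univ) := by
    have h1 : CyclicOn (Perm.sumCongr d (finRotate (i + 1)))
        (S.map (Function.Embedding.inl : α ↪ α ⊕ Fin (i + 1))) := by
      have hp : ∀ (j : ℕ) (u : α), (Perm.sumCongr d (finRotate (i + 1)) ^ j) (Sum.inl u) =
          Sum.inl ((d ^ j) u) := by
        intro j
        induction j with
        | zero => simp
        | succ j ih => intro u; rw [pow_succ, mul_apply, pow_succ, mul_apply, ← ih]; simp
      refine ⟨?_, ?_⟩
      · simp only [Finset.mem_map, Function.Embedding.inl_apply]
        rintro _ ⟨u, hu, rfl⟩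
        exact ⟨d u, h.cyc.1 u hu, by simp⟩
      · simp only [Finset.mem_map, Function.Embedding.inl_apply]
        rintro _ ⟨u, hu, rfl⟩ _ ⟨v, hv, rfl⟩
        obtain ⟨j, hj⟩ := h.cyc.2 u hu v hv
        exact ⟨j, by rw [hp, hj]⟩
    have h2 : CyclicOn (Perm.sumCongr d (finRotate (i + 1)))
        (Finset.univ.map (Function.Embedding.inr : Fin (i + 1) ↪ α ⊕ Fin (i + 1))) := by
      have hp : ∀ (j : ℕ) (u : Fin (i + 1)), (Perm.sumCongr d (finRotate (i + 1)) ^ j)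
          (Sum.inr u) = Sum.inr ((finRotate (i + 1) ^ j) u) := by
        intro j
        induction j with
        | zero => simp
        | succ j ih => intro u; rw [pow_succ, mul_apply, pow_succ, mul_apply, ← ih]; simp
      refine ⟨?_, ?_⟩
      · simp only [Finset.mem_map, Function.Embedding.inr_apply]
        rintro _ ⟨u, hu, rfl⟩
        exact ⟨finRotate (i + 1) u, Finset.mem_univ _, by simp⟩
      · simp only [Finset.mem_map, Function.Embedding.inr_apply]
        rintro _ ⟨u, hu, rfl⟩ _ ⟨v, hv, rfl⟩
        obtain ⟨j, hj⟩ := (cyclicOn_finRotate i.succ_pos).2 u hu v hv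
        exact ⟨j, by rw [hp, hj]⟩
    have h3 := h1.swap_mul h2 (z := Sum.inl z) (w := Sum.inr 0) ?_ ?_ ?_
    · rwa [show S.map (Function.Embedding.inl : α ↪ α ⊕ Fin (i + 1)) ∪
          Finset.univ.map Function.Embedding.inr = S.disjSum Finset.univ from by
            ext (u | u) <;> simp] at h3
    · rw [Finset.disjoint_left]
      rintro (u | u) <;> simp
    · simpa using h.sub hz
    · simp
  refine ⟨?_, ?_, ?_, ?_, hcyc, ?_, ?_, ?_, ?_, ?_⟩
  · nth_rewrite 2 [hcomm]
    rw [mul_assoc, ← mul_assoc (Perm.sumCongr a 1) (Perm.sumCongr a 1), Perm.sumCongr_mul, h.inv,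
      mul_one, Perm.sumCongr_one, one_mul, swap_mul_self]
  · rw [mul_assoc, Perm.sumCongr_mul, h.prod, one_mul, ← one_mul (finRotate (i + 1)),
      ← Perm.sumCongr_mul, ← mul_assoc, htc, mul_assoc, one_mul]
  · rw [support_sumCongr_one, Finset.card_map, h.card_support]
  · rintro (u | u) hu
    · simpa using h.fix u (by simpa using hu)
    · simp
  · rintro (u | u) hu
    · have huS : u ∉ S := by simpa using hu
      rw [mul_apply, Perm.sumCongr_apply, Sum.map_inl, h.fix' u huS,
        swap_apply_of_ne_of_ne _ (by simp)]
      rintro h'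
      exact huS (Sum.inl.inj h' ▸ h.sub hz)
    · simp at hu
  · exact Finset.disjSum_mono ((Finset.erase_subset _ _).trans h.sub) (Finset.erase_subset _ _)
  · rintro (u | u) hu
    · simp only [Finset.inl_mem_disjSum, Finset.mem_erase] at hu
      rw [hval u hu.1, h.slots u hu.2]
    · simp only [Finset.inr_mem_disjSum, Finset.mem_erase] at hu
      exact hval' u hu.1
  · obtain ⟨w, hw, haw⟩ := h.exists_fixed
    have hne : w ≠ z := by rintro rfl; exact mem_support.1 hw htz
    exact ⟨Sum.inl w, by rw [support_sumCongr_one]; simpa using hw, by rw [hval w hne, haw]⟩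
  · intro B hB h1 h2
    have hr : ∀ u : Fin (i + 1), Sum.inr u ∈ B → ∀ v : Fin (i + 1), Sum.inr v ∈ B := by
      intro u hu v
      exact (cyclicOn_finRotate i.succ_pos).mem_of_forall_mem (B := {v | Sum.inr v ∈ B})
        (fun u hu => by simpa using h2 _ hu) (Finset.mem_univ u) hu (Finset.mem_univ v)
    have hl : (∃ u, Sum.inl u ∈ B) → ∀ v, Sum.inl v ∈ B := by
      intro hne v
      have := h.trans {v | Sum.inl v ∈ B} hne (fun u hu => ?_)
        (fun u hu => by simpa using h2 _ hu)
      · exact Set.eq_univ_iff_forall.1 this v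
      · by_cases huz : u = z
        · subst huz
          change Sum.inl (a u) ∈ B
          rwa [haz]
        · change Sum.inl (a u) ∈ B
          rw [← hval u huz]
          exact h1 _ hu
    have hlr : (∃ u, Sum.inl u ∈ B) → B = Set.univ := by
      intro hne
      rw [Set.eq_univ_iff_forall]
      rintro (v | v)
      · exact hl hne v
      · exact hr 0 (hvz ▸ h1 _ (hl hne z)) v
    obtain ⟨u | u, hu⟩ := hB
    · exact hlr ⟨u, hu⟩
    · exact hlr ⟨z, hv0 ▸ h1 _ (hr u hu 0)⟩

end Config

/-! ### Numerical invariants of configurations -/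

/-- The symmetric group on `n` points contains two elements of order `k` and sign `ε` that
generate a group containing the alternating group. -/
def GeneratedByPair (n k : ℕ) (ε : ℤˣ) : Prop :=
  ∃ x y : Perm (Fin n), orderOf x = k ∧ orderOf y = k ∧ sign x = ε ∧ sign y = ε ∧
    alternatingGroup (Fin n) ≤ Subgroup.closure {x, y}

/-- There is a configuration on `n` points with at least `s` slots, whose large cycle has length
`L` and whose permutation `b` has order `m` and sign `ε`. -/
def Reachable (r n s L m : ℕ) (ε : ℤˣ) : Prop :=
  ∃ (α : Type) (_ : Fintype α) (_ : DecidableEq α) (a b t d : Perm α) (S Z : Finset α),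
    Config r a b t d S Z ∧ Fintype.card α = n ∧ s ≤ Z.card ∧ S.card = L ∧ orderOf b = m ∧
      sign b = ε

/-- The pair is `b` and `a * b * a⁻¹`; being conjugate, they share order and sign. -/
lemma Reachable.generatedByPair {r n s L m : ℕ} {ε : ℤˣ} (h : Reachable r n s L m ε)
    (hr : r = 2 ∨ r = 3) (hL : r.Coprime L) (hn : 5 ≤ n) (hm : 3 ≤ m) :
    GeneratedByPair n m ε := by
  obtain ⟨α, _, _, a, b, t, d, S, Z, h, rfl, -, rfl, rfl, rfl⟩ := h
  have key := alternatingGroup_le_closure_conj (by rwa [Nat.card_eq_fintype_card]) h.inv hm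
    (h.alternatingGroup_le hr hL)
  let e : α ≃ Fin (Fintype.card α) := Fintype.equivFin α
  have hord : ∀ g : Perm α, orderOf (e.permCongrHom g) = orderOf g := fun g =>
    MulEquiv.orderOf_eq _ g
  have hsign : ∀ g : Perm α, sign (e.permCongrHom g) = sign g := fun g => sign_permCongr e g
  refine ⟨e.permCongrHom b, e.permCongrHom (a * b * a⁻¹), hord b, ?_, hsign b, ?_, ?_⟩
  · rw [hord]
    exact (MulEquiv.orderOf_eq (MulAut.conj a) b)
  · rw [hsign, Perm.sign_mul, Perm.sign_mul, sign_inv, mul_right_comm, Int.units_mul_self, one_mul]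
  · intro g hg
    have hg' : e.permCongrHom.symm g ∈ alternatingGroup α := by
      rw [mem_alternatingGroup] at hg ⊢
      rw [← hsign, MulEquiv.apply_symm_apply, hg]
    have := Subgroup.mem_map_of_mem e.permCongrHom.toMonoidHom (key hg')
    rw [MonoidHom.map_closure, Set.image_pair] at this
    exact (e.permCongrHom.apply_symm_apply g) ▸ this

namespace Reachable

variable {r n s L m : ℕ} {ε : ℤˣ}

/-- One slot is used, and all points of the new cycle except its point of attachment become slots.
-/
lemma attach (h : Reachable r n (s + 1) L m ε) (i : ℕ) :
    Reachable r (n + (i + 1)) (s + i) (L + (i + 1)) (Nat.lcm m (i + 1)) (ε * (-1) ^ i) := by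
  obtain ⟨α, _, _, a, b, t, d, S, Z, h, rfl, hs, rfl, rfl, rfl⟩ := h
  obtain ⟨z, hz⟩ : Z.Nonempty := Finset.card_pos.1 (by omega)
  refine ⟨_, inferInstance, inferInstance, _, _, _, _, _, _, h.attach hz i, by simp, ?_, by simp,
    ?_, ?_⟩
  · rw [Finset.card_disjSum, Finset.card_erase_of_mem hz, Finset.card_erase_of_mem (by simp)]
    simp only [Finset.card_univ, Fintype.card_fin]
    omega
  · rw [orderOf_sumCongr, orderOf_finRotate]
  · rw [sign_sumCongr, sign_finRotate, Nat.add_sub_cancel]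

/-- Attaching a cycle of length at least three, two neighbours of which are joined. -/
lemma attachLoop (h : Reachable r n (s + 1) L m ε) (i : ℕ) :
    Reachable r (n + (i + 3)) (s + i) (L + (i + 2)) (Nat.lcm m (i + 3))
      (ε * (-1) ^ (i + 2)) := by
  obtain ⟨α, _, _, a, b, t, d, S, Z, h, rfl, hs, rfl, rfl, rfl⟩ := h
  obtain ⟨z, hz⟩ : Z.Nonempty := Finset.card_pos.1 (by omega)
  have h' := h.attach hz (i + 2)
  have h12 : finRotate (i + 2 + 1) 1 = 2 := by
    rw [finRotate_apply]; rfl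
  have hb : (Perm.sumCongr b (finRotate (i + 2 + 1))) (Sum.inr 1) = Sum.inr 2 := by
    simp [h12]
  have h10 : (1 : Fin (i + 2 + 1)) ≠ 0 := by simp
  have h20 : (2 : Fin (i + 2 + 1)) ≠ 0 := by
    intro h; have := congrArg Fin.val h
    simp [Nat.mod_eq_of_lt (show 2 < i + 2 + 1 by omega)] at this
  have h21 : (2 : Fin (i + 2 + 1)) ≠ 1 := by
    intro h; have := congrArg Fin.val h
    simp [Nat.mod_eq_of_lt (show 2 < i + 2 + 1 by omega)] at this
  -- The neighbours 1 and 2 are still free, as the new cycle is attached at 0. The loop costs both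
  -- slots and one unit of length, which is how the residue of `L` is adjusted.
  have hl := h'.loop (u := Sum.inr 1) (by simp) (by rw [hb]; simpa using h20)
    (by rw [hb]; simpa using h21)
  refine ⟨_, inferInstance, inferInstance, _, _, _, _, _, _, hl, by simp, ?_, ?_, ?_, ?_⟩
  · rw [hb, Finset.card_erase_of_mem (by simp [h20, h21]), Finset.card_erase_of_mem (by simp),
      Finset.card_disjSum, Finset.card_erase_of_mem hz, Finset.card_erase_of_mem (by simp)]
    simp only [Finset.card_univ, Fintype.card_fin]
    omega
  · rw [Finset.card_erase_of_mem (by simp), Finset.card_disjSum]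
    simp only [Finset.card_univ, Fintype.card_fin]
    omega
  · rw [orderOf_sumCongr, orderOf_finRotate]
  · rw [sign_sumCongr, sign_finRotate]; simp

lemma mono (h : Reachable r n s L m ε) {s' : ℕ} (hs : s' ≤ s) : Reachable r n s' L m ε := by
  obtain ⟨α, _, _, a, b, t, d, S, Z, h, h1, h2, h3⟩ := h
  exact ⟨α, _, _, a, b, t, d, S, Z, h, h1, hs.trans h2, h3⟩

end Reachable

/-! ### Basic configurations -/

/-- A single cycle, two points of which at distance `r` are joined. -/
lemma config_finRotate {n r : ℕ} (hr : 2 ≤ r) (hrn : r < n) (t : Perm (Fin n))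
    (ht : t.support.card = r) (hfix : ∀ u : Fin n, r ≤ u → t u = u)
    (ht' : ∀ u : Fin n, ∀ h : (u : ℕ) < r,
      t u = if (u : ℕ) + 1 = r then ⟨0, by omega⟩ else ⟨u + 1, by omega⟩) :
    Config r (swap ⟨0, by omega⟩ ⟨r, hrn⟩) (finRotate n) t
      (t⁻¹ * (swap ⟨0, by omega⟩ ⟨r, hrn⟩ * finRotate n))
      (Finset.Ici ⟨r, hrn⟩) (Finset.Ioi ⟨r, hrn⟩) := by
  -- (0 r) splits the rotation into 0 → 1 → ⋯ → r-1 → 0, which is `t`, and r → ⋯ → n-1 → r. The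
  -- point 1 lies on `t` and is fixed by (0 r).
  have hlt : ∀ u : Fin n, (u : ℕ) < r →
      (swap (⟨0, by omega⟩ : Fin n) ⟨r, hrn⟩ * finRotate n) u = t u := by
    intro u hu
    rw [mul_apply, finRotate_apply_of_lt u (by omega), ht' u hu, swap_apply_def]
    simp only [Fin.mk.injEq, Nat.add_eq_zero_iff, one_ne_zero, and_false, if_false]
  have hinv : ∀ u : Fin n, r ≤ u → t⁻¹ u = u := fun u hu => by
    rw [inv_eq_iff_eq, hfix u hu]
  have hsucc : ∀ u : Fin n, r ≤ u → ∀ h : (u : ℕ) + 1 < n,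
      (t⁻¹ * (swap (⟨0, by omega⟩ : Fin n) ⟨r, hrn⟩ * finRotate n)) u = ⟨u + 1, h⟩ := by
    intro u hu h
    rw [mul_apply, mul_apply, finRotate_apply_of_lt u h, swap_apply_of_ne_of_ne, hinv]
    · simp only; omega
    · simp [Fin.ext_iff]
    · simp only [ne_eq, Fin.mk.injEq]; omega
  have hlast : ∀ u : Fin n, (u : ℕ) + 1 = n →
      (t⁻¹ * (swap (⟨0, by omega⟩ : Fin n) ⟨r, hrn⟩ * finRotate n)) u = ⟨r, hrn⟩ := by
    intro u h
    rw [mul_apply, mul_apply, finRotate_apply_of_eq u h, swap_apply_left, hinv _ le_rfl]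
  refine ⟨swap_mul_self _ _, by rw [mul_inv_cancel_left], ht, fun u hu => ?_, ?_, fun u hu => ?_,
    Finset.Ioi_subset_Ici_self, fun u hu => ?_, ⟨⟨1, by omega⟩, ?_, ?_⟩, fun B hB h1 h2 => ?_⟩
  · exact hfix u (by simpa [Fin.le_def] using hu)
  · convert! cyclicOn_of_succ hrn hsucc hlast
    ext u; simp [Fin.le_def]
  · have hu' : (u : ℕ) < r := by simpa [Fin.lt_def] using hu
    rw [mul_apply, hlt u hu', ← mul_apply, inv_mul_cancel, one_apply]
  · have hu' : r < (u : ℕ) := by simpa [Fin.lt_def] using hu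
    rw [swap_apply_of_ne_of_ne] <;> · rw [ne_eq, Fin.ext_iff]; simp only; omega
  · rw [mem_support, ht' _ (by simp only; omega)]
    split_ifs <;> simp [Fin.ext_iff]
  · rw [swap_apply_of_ne_of_ne] <;> · rw [ne_eq, Fin.ext_iff]; simp only; omega
  · obtain ⟨u, hu⟩ := hB
    rw [Set.eq_univ_iff_forall]
    intro v
    exact (cyclicOn_finRotate (by omega)).mem_of_forall_mem h2 (Finset.mem_univ u) hu
      (Finset.mem_univ v)

lemma exists_config_finRotate {n r : ℕ} (hr : r = 2 ∨ r = 3) (hrn : r < n) :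
    ∃ t d : Perm (Fin n), Config r (swap ⟨0, by omega⟩ ⟨r, hrn⟩) (finRotate n) t d
      (Finset.Ici ⟨r, hrn⟩) (Finset.Ioi ⟨r, hrn⟩) := by
  rcases hr with rfl | rfl
  · refine ⟨_, _, config_finRotate le_rfl hrn (swap ⟨0, by omega⟩ ⟨1, by omega⟩) ?_ ?_ ?_⟩
    · rw [card_support_swap]; simp
    · intro u hu
      rw [swap_apply_of_ne_of_ne] <;> · rw [ne_eq, Fin.ext_iff]; simp only; omega
    · rintro ⟨u, hu'⟩ hu
      simp only at hu
      interval_cases u <;> simp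
  · refine ⟨_, _, config_finRotate (by norm_num) hrn
      (swap ⟨0, by omega⟩ ⟨1, by omega⟩ * swap ⟨1, by omega⟩ ⟨2, by omega⟩) ?_ ?_ ?_⟩
    · rw [card_support_eq_three_iff, swap_comm]
      exact isThreeCycle_swap_mul_swap_same (by simp) (by simp) (by simp)
    · intro u hu
      have h : ∀ i : ℕ, ∀ hi : i < n, i < 3 → u ≠ ⟨i, hi⟩ := by
        intro i hi h; rw [ne_eq, Fin.ext_iff]; simp only; omega
      rw [mul_apply, swap_apply_of_ne_of_ne (h 1 _ (by norm_num)) (h 2 _ (by norm_num)),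
        swap_apply_of_ne_of_ne (h 0 _ (by norm_num)) (h 1 _ (by norm_num))]
    · rintro ⟨u, hu'⟩ hu
      simp only at hu
      interval_cases u <;> simp [swap_apply_def]

lemma sign_and_orderOf_finRotate {n : ℕ} (hn : 0 < n) :
    orderOf (finRotate n) = n ∧ sign (finRotate n) = (-1) ^ (n - 1) := by
  obtain ⟨i, rfl⟩ : ∃ i, n = i + 1 := ⟨n - 1, by omega⟩
  exact ⟨orderOf_finRotate i, sign_finRotate _⟩

lemma reachable_base {n r : ℕ} (hr : r = 2 ∨ r = 3) (hrn : r < n) :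
    Reachable r n (n - r - 1) (n - r) n ((-1) ^ (n - 1)) := by
  obtain ⟨t, d, h⟩ := exists_config_finRotate hr hrn
  have := sign_and_orderOf_finRotate (n := n) (by omega)
  exact ⟨_, _, _, _, _, _, _, _, _, h, by simp, by simp; omega, by simp, this.1, this.2⟩

/-- A loop at r+1, r+2 changes the parity of the large cycle's length, at the price of two slots. -/
lemma reachable_baseLoop {n r : ℕ} (hr : r = 2 ∨ r = 3) (hrn : r + 2 < n) :
    Reachable r n (n - r - 3) (n - r - 1) n ((-1) ^ (n - 1)) := by
  obtain ⟨t, d, h⟩ := exists_config_finRotate hr (by omega : r < n)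
  have := sign_and_orderOf_finRotate (n := n) (by omega)
  have hb : finRotate n ⟨r + 1, by omega⟩ = ⟨r + 2, hrn⟩ := finRotate_apply_of_lt _ _
  have hl := h.loop (u := ⟨r + 1, by omega⟩) (by simp [Fin.lt_def]) (by rw [hb]; simp [Fin.lt_def])
    (by rw [hb]; simp)
  refine ⟨_, _, _, _, _, _, _, _, _, hl, by simp, ?_, ?_, this.1, this.2⟩
  · rw [hb, Finset.card_erase_of_mem (by simp [Fin.lt_def]),
      Finset.card_erase_of_mem (by simp [Fin.lt_def])]
    simp; omega
  · rw [Finset.card_erase_of_mem (by simp [Fin.le_def])]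
    simp

/-- Every point descends to 0 along edges of `x` and `y`; by finiteness an invariant set is also
closed under inverses. The criterion can be checked by `decide`. -/
lemma transitivePair_of_forall_exists_lt {n : ℕ} [NeZero n] {x y : Perm (Fin n)}
    (h : ∀ u ≠ 0, ∃ v < u, x v = u ∨ y v = u ∨ x u = v ∨ y u = v) : TransitivePair x y := by
  intro B ⟨u₀, hu₀⟩ hx hy
  have hback : ∀ g : Perm (Fin n), (∀ u ∈ B, g u ∈ B) → ∀ u, g u ∈ B → u ∈ B := by
    intro g hg u hu
    have hpow : ∀ i : ℕ, (g ^ i) (g u) ∈ B := by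
      intro i
      induction i with
      | zero => exact hu
      | succ i ih => rw [pow_succ', mul_apply]; exact hg _ ih
    have := hpow (orderOf g - 1)
    rwa [← mul_apply, ← pow_succ, Nat.sub_add_cancel (orderOf_pos g), pow_orderOf_eq_one] at this
  have key : ∀ k : ℕ, ∀ u : Fin n, (u : ℕ) = k → (u ∈ B ↔ 0 ∈ B) := by
    intro k
    induction k using Nat.strong_induction_on with
    | _ k ih =>
      rintro u rfl
      by_cases hu : u = 0
      · rw [hu]
      obtain ⟨v, hv, h⟩ := h u hu
      rw [← ih v hv v rfl]
      rcases h with rfl | rfl | rfl | rfl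
      · exact ⟨hback x hx v, hx v⟩
      · exact ⟨hback y hy v, hy v⟩
      · exact ⟨hx u, hback x hx u⟩
      · exact ⟨hy u, hback y hy u⟩
  have h0 : 0 ∈ B := (key _ u₀ rfl).1 hu₀
  exact Set.eq_univ_iff_forall.2 fun u => (key _ u rfl).2 h0

/-- Two 3-cycles of `b` joined by two edges. -/
lemma reachable_two_triangles : Reachable 3 6 1 3 3 1 := by
  have hb : (swap 0 1 * swap 1 2 * (swap 3 4 * swap 4 5) : Perm (Fin 6)) ^ 3 = 1 := by decide
  refine ⟨Fin 6, _, _, swap 0 3 * swap 1 4, swap 0 1 * swap 1 2 * (swap 3 4 * swap 4 5),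
    swap 1 2 * swap 2 3, swap 0 4 * swap 4 5, {0, 4, 5}, {5}, ⟨by decide, by decide, by decide,
      by decide, ⟨by decide, ?_⟩, by decide, by decide, by decide, by decide,
      transitivePair_of_forall_exists_lt (by decide)⟩, by simp, by simp, by simp,
      orderOf_eq_prime hb (by decide), by decide⟩
  have : ∀ u ∈ ({0, 4, 5} : Finset (Fin 6)), ∀ v ∈ ({0, 4, 5} : Finset (Fin 6)),
      ∃ i < 3, ((swap 0 4 * swap 4 5 : Perm (Fin 6)) ^ i) u = v := by decide
  intro u hu v hv
  obtain ⟨i, -, hi⟩ := this u hu v hv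
  exact ⟨i, hi⟩

/-! ### Two overlapping cycles of odd length -/

section TwoCycles

variable {k f : ℕ}

/-- The cycle `(0 1 ⋯ k-1)` on `k + f` points. -/
def headCycle (k f : ℕ) (hk : 0 < k) : Perm (Fin (k + f)) :=
  Fin.cycleRange ⟨k - 1, by omega⟩

/-- The cycle `(f f+1 ⋯ k+f-1)` on `k + f` points. -/
def tailCycle (k f : ℕ) (hk : 0 < k) : Perm (Fin (k + f)) :=
  Fin.revPerm * (headCycle k f hk)⁻¹ * Fin.revPerm⁻¹

lemma headCycle_val (hk : 0 < k) (u : Fin (k + f)) :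
    (headCycle k f hk u : ℕ) = if (u : ℕ) + 1 < k then (u : ℕ) + 1
      else if (u : ℕ) + 1 = k then 0 else u := by
  rw [headCycle]
  by_cases h : u ≤ (⟨k - 1, by omega⟩ : Fin (k + f))
  · rw [Fin.coe_cycleRange_of_le h]
    rw [Fin.le_def] at h
    simp only [Fin.ext_iff] at h ⊢
    split_ifs <;> omega
  · rw [Fin.cycleRange_of_gt (not_le.1 h)]
    rw [not_le, Fin.lt_def] at h
    simp only at h
    split_ifs <;> omega

lemma tailCycle_val (hk : 0 < k) (u : Fin (k + f)) :
    (tailCycle k f hk u : ℕ) = if (u : ℕ) < f then (u : ℕ)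
      else if (u : ℕ) + 1 = k + f then f else u + 1 := by
  have hu := u.2
  have hlt : (if (u : ℕ) < f then (u : ℕ) else if (u : ℕ) + 1 = k + f then f else u + 1) < k + f := by
    split_ifs <;> omega
  have : tailCycle k f hk u =
      ⟨if (u : ℕ) < f then (u : ℕ) else if (u : ℕ) + 1 = k + f then f else u + 1, hlt⟩ := by
    rw [tailCycle, mul_assoc, mul_apply, ← eq_inv_iff_eq, mul_apply, inv_eq_iff_eq, Fin.ext_iff,
      headCycle_val]
    simp only [Perm.inv_def, Fin.revPerm_symm, Fin.revPerm_apply, Fin.val_rev]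
    split_ifs <;> omega
  rw [this]

lemma isCycle_tailCycle (hk : 2 ≤ k) : (tailCycle k f (by omega)).IsCycle := by
  have : NeZero (k + f) := ⟨by omega⟩
  refine IsCycle.conj (IsCycle.inv (Fin.isCycle_cycleRange ?_))
  rw [ne_eq, Fin.ext_iff]
  simp; omega

lemma orderOf_headCycle (hk : 2 ≤ k) : orderOf (headCycle k f (by omega)) = k := by
  have : NeZero (k + f) := ⟨by omega⟩
  rw [← lcm_cycleType, headCycle, Fin.cycleType_cycleRange]
  · simp; omega
  · rw [ne_eq, Fin.ext_iff]
    simp; omega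

lemma orderOf_tailCycle (hk : 2 ≤ k) : orderOf (tailCycle k f (by omega)) = k := by
  have h := MulEquiv.orderOf_eq (MulAut.conj Fin.revPerm) (headCycle k f (by omega))⁻¹
  rw [orderOf_inv, orderOf_headCycle hk] at h
  exact h

lemma sign_headCycle (hk : 0 < k) : sign (headCycle k f hk) = (-1) ^ (k - 1) := by
  rw [headCycle, Fin.sign_cycleRange]

lemma sign_tailCycle (hk : 0 < k) : sign (tailCycle k f hk) = (-1) ^ (k - 1) := by
  rw [tailCycle, Perm.sign_mul, Perm.sign_mul, Perm.sign_inv, Perm.sign_inv, mul_right_comm,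
    Int.units_mul_self, one_mul, sign_headCycle]

lemma transitivePair_headCycle_tailCycle (hf : 1 ≤ f) (hfk : f < k) :
    TransitivePair (headCycle k f (by omega)) (tailCycle k f (by omega)) := by
  have : NeZero (k + f) := ⟨by omega⟩
  refine transitivePair_of_forall_exists_lt fun u hu => ?_
  have hu' : (u : ℕ) ≠ 0 := fun h => hu (Fin.ext (by simpa using h))
  refine ⟨⟨u - 1, by omega⟩, by rw [Fin.lt_def]; simp only; omega, ?_⟩
  by_cases h : (u : ℕ) < k
  · left
    rw [Fin.ext_iff, headCycle_val]
    simp only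
    split_ifs <;> omega
  · right; left
    rw [Fin.ext_iff, tailCycle_val]
    simp only
    split_ifs <;> omega

/-- Linear alternatives let `omega` compare products of permutations pointwise. -/
lemma headCycle_spec (hk : 0 < k) (u : Fin (k + f)) :
    ((u : ℕ) + 1 < k ∧ (headCycle k f hk u : ℕ) = u + 1) ∨
      ((u : ℕ) + 1 = k ∧ (headCycle k f hk u : ℕ) = 0) ∨
      (k ≤ (u : ℕ) ∧ (headCycle k f hk u : ℕ) = u) := by
  rw [headCycle_val]
  split_ifs <;> omega

lemma tailCycle_spec (hk : 0 < k) (u : Fin (k + f)) :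
    ((u : ℕ) < f ∧ (tailCycle k f hk u : ℕ) = u) ∨
      (f ≤ (u : ℕ) ∧ (u : ℕ) + 1 = k + f ∧ (tailCycle k f hk u : ℕ) = f) ∨
      (f ≤ (u : ℕ) ∧ (u : ℕ) + 1 < k + f ∧ (tailCycle k f hk u : ℕ) = u + 1) := by
  have := u.2
  rw [tailCycle_val]
  split_ifs <;> omega

lemma swap_val_spec {n : ℕ} (p q u : Fin n) :
    ((u : ℕ) = p ∧ (swap p q u : ℕ) = q) ∨ ((u : ℕ) = q ∧ (swap p q u : ℕ) = p) ∨
      ((u : ℕ) ≠ p ∧ (u : ℕ) ≠ q ∧ (swap p q u : ℕ) = u) := by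
  rw [swap_apply_def]
  simp only [Fin.ext_iff]
  split_ifs <;> omega

/-- If the cycles have one point in common, their commutator is a 3-cycle. -/
lemma commutator_of_eq (hk : 2 ≤ k) (hf : f + 1 = k) :
    headCycle k f (by omega) * tailCycle k f (by omega) * (headCycle k f (by omega))⁻¹ *
      (tailCycle k f (by omega))⁻¹ =
    swap ⟨0, by omega⟩ ⟨f, by omega⟩ * swap ⟨0, by omega⟩ ⟨k, by omega⟩ := by
  rw [mul_inv_eq_iff_eq_mul, mul_inv_eq_iff_eq_mul]
  ext u
  have hu := u.2
  simp only [mul_apply]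
  have h1 := tailCycle_spec (f := f) (by omega : 0 < k) u
  have h2 := headCycle_spec (by omega : 0 < k) (tailCycle k f (by omega) u)
  have h3 := headCycle_spec (f := f) (by omega : 0 < k) u
  have h4 := tailCycle_spec (by omega : 0 < k) (headCycle k f (by omega) u)
  have h5 := swap_val_spec ⟨0, by omega⟩ ⟨k, by omega⟩
    (tailCycle k f (by omega) (headCycle k f (by omega) u))
  have h6 := swap_val_spec ⟨0, by omega⟩ ⟨f, by omega⟩ (swap ⟨0, by omega⟩ ⟨k, by omega⟩
    (tailCycle k f (by omega) (headCycle k f (by omega) u)))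
  simp only at h5 h6
  omega

/-- With two or more common points the commutator is only a product of two disjoint transpositions;
it is the raw material for the next 3-cycle. -/
lemma commutator_of_lt (hf : 1 ≤ f) (hfk : f + 2 ≤ k) :
    headCycle k f (by omega) * tailCycle k f (by omega) * (headCycle k f (by omega))⁻¹ *
      (tailCycle k f (by omega))⁻¹ =
    swap ⟨f, by omega⟩ ⟨f + 1, by omega⟩ * swap ⟨0, by omega⟩ ⟨k, by omega⟩ := by
  rw [mul_inv_eq_iff_eq_mul, mul_inv_eq_iff_eq_mul]
  ext u
  have hu := u.2
  simp only [mul_apply]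
  have h1 := tailCycle_spec (f := f) (by omega : 0 < k) u
  have h2 := headCycle_spec (by omega : 0 < k) (tailCycle k f (by omega) u)
  have h3 := headCycle_spec (f := f) (by omega : 0 < k) u
  have h4 := tailCycle_spec (by omega : 0 < k) (headCycle k f (by omega) u)
  have h5 := swap_val_spec ⟨0, by omega⟩ ⟨k, by omega⟩
    (tailCycle k f (by omega) (headCycle k f (by omega) u))
  have h6 := swap_val_spec ⟨f, by omega⟩ ⟨f + 1, by omega⟩ (swap ⟨0, by omega⟩ ⟨k, by omega⟩
    (tailCycle k f (by omega) (headCycle k f (by omega) u)))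
  simp only at h5 h6
  omega

lemma tailCycle_pow_val (hk : 0 < k) (j : ℕ) (u : Fin (k + f)) (hu : f ≤ u)
    (hj : (u : ℕ) + j < k + f) : ((tailCycle k f hk ^ j) u : ℕ) = u + j := by
  induction j with
  | zero => simp
  | succ j ih =>
    rw [pow_succ', mul_apply]
    have := tailCycle_spec hk ((tailCycle k f hk ^ j) u)
    have := ih (by omega)
    omega

lemma tailCycle_inv (hk : 0 < k) :
    (tailCycle k f hk)⁻¹ = Fin.revPerm * headCycle k f hk * Fin.revPerm⁻¹ := by
  rw [tailCycle]; group

/-- For odd `k`, the group generated by two cycles of length `k` with between two and `k - 2`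
common points contains a 3-cycle. -/
lemma swap_mul_swap_mem_closure (hk : Odd k) (hf : 2 ≤ f) (hfk : f + 2 ≤ k) :
    swap ⟨0, by omega⟩ ⟨f - 1, by omega⟩ * swap ⟨0, by omega⟩ ⟨k, by omega⟩ ∈
      Subgroup.closure {headCycle k f (by omega), tailCycle k f (by omega)} := by
  -- Let D = (F F')(o q) be the commutator. The reversal ρ exchanges `x` with y⁻¹, so ρDρ⁻¹ also
  -- lies in G; a power of `y` moves it to (U V)(q Q). Conjugating D by this yields (F F')(o Q),
  -- whose product with D is a 3-cycle.
  have hk0 : 0 < k := by omega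
  have hcomm := commutator_of_lt (by omega : 1 ≤ f) hfk
  set x := headCycle k f hk0 with hx
  set y := tailCycle k f hk0 with hy
  set G := Subgroup.closure {x, y} with hG
  have hxG : x ∈ G := Subgroup.subset_closure (by simp)
  have hyG : y ∈ G := Subgroup.subset_closure (by simp)
  set o : Fin (k + f) := ⟨0, by omega⟩ with ho
  set q : Fin (k + f) := ⟨k, by omega⟩ with hq
  set F : Fin (k + f) := ⟨f, by omega⟩ with hF
  set F' : Fin (k + f) := ⟨f + 1, by omega⟩ with hF'
  set Q : Fin (k + f) := ⟨f - 1, by omega⟩ with hQ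
  set ρ : Perm (Fin (k + f)) := Fin.revPerm with hρ
  have hρv : ∀ u : Fin (k + f), ((ρ u : Fin (k + f)) : ℕ) = k + f - (u + 1) := fun u => by
    rw [hρ, Fin.revPerm_apply, Fin.val_rev]
  have hyfix : ∀ u : Fin (k + f), (u : ℕ) < f → y u = u := by
    intro u hu
    have := tailCycle_spec hk0 u
    rw [Fin.ext_iff, hy]; omega
  have hyi : y⁻¹ = ρ * x * ρ⁻¹ := tailCycle_inv hk0
  have hρi : ρ⁻¹ = ρ := by rw [hρ, Perm.inv_def, Fin.revPerm_symm]
  have hxi : x⁻¹ = ρ * y * ρ⁻¹ := by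
    rw [← inv_inv y, hyi, hρi]
    have : ρ * ρ = 1 := by nth_rewrite 1 [← hρi]; exact inv_mul_cancel _
    rw [mul_inv_rev, mul_inv_rev, hρi, ← mul_assoc, ← mul_assoc, this, one_mul, mul_assoc, this,
      mul_one]
  -- the commutator of the inverses
  have hE : swap (ρ F) (ρ F') * swap (ρ o) (ρ q) ∈ G := by
    have : swap (ρ F) (ρ F') * swap (ρ o) (ρ q) = y⁻¹ * x⁻¹ * y * x := by
      have h1 : swap (ρ F) (ρ F') * swap (ρ o) (ρ q) = ρ * (x * y * x⁻¹ * y⁻¹) * ρ⁻¹ := by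
        rw [hcomm]; simp only [swap_apply_apply]; group
      have h2 : y = ρ * x⁻¹ * ρ⁻¹ := by
        rw [← inv_inv y, hyi]; group
      have h3 : x = ρ * y⁻¹ * ρ⁻¹ := by
        rw [← inv_inv x, hxi]; group
      calc _ = (ρ * x * ρ⁻¹) * (ρ * y * ρ⁻¹) * (ρ * x⁻¹ * ρ⁻¹) * (ρ * y⁻¹ * ρ⁻¹) := by
            rw [h1]; group
        _ = _ := by rw [← h2, ← h3, ← hyi, ← hxi]
    rw [this]
    exact mul_mem (mul_mem (mul_mem (inv_mem hyG) (inv_mem hxG)) hyG) hxG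
  obtain ⟨s, hs⟩ : ∃ s, k = f + s := ⟨k - f, by omega⟩
  -- The exponent carries ρ o = k+f-1 through f to f+s = k, while ρ q = f-1 stays fixed.
  set g := y ^ (s + 1) with hg
  have hgG : g ∈ G := G.pow_mem hyG _
  have hgfix : ∀ u : Fin (k + f), (u : ℕ) < f → g u = u := fun u hu =>
    pow_apply_eq_self_of_apply_eq_self (hyfix u hu) _
  have hgq : g (ρ q) = Q := by
    rw [hgfix]
    · rw [Fin.ext_iff, hρv]; simp only [hq, hQ]; omega
    · rw [hρv]; simp only [hq]; omega
  have hgo : g (ρ o) = q := by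
    have h1 : y (ρ o) = F := by
      have := tailCycle_spec hk0 (ρ o)
      have := hρv o
      rw [Fin.ext_iff, hy]; simp only [ho, hF] at *; omega
    rw [hg, pow_succ, mul_apply, h1, Fin.ext_iff, tailCycle_pow_val hk0 _ _ le_rfl]
    · simp only [hF, hq]; omega
    · simp only [hF]; omega
  set U := g (ρ F) with hU
  set V := g (ρ F') with hV
  have hE' : swap U V * swap q Q ∈ G := by
    have : swap U V * swap q Q = g * (swap (ρ F) (ρ F') * swap (ρ o) (ρ q)) * g⁻¹ := by
      rw [hU, hV, ← hgq, ← hgo]; simp only [swap_apply_apply]; group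
    rw [this]
    exact mul_mem (mul_mem hgG hE) (inv_mem hgG)
  have hyV : y V = U := by
    have h1 : y (ρ F') = ρ F := by
      have := tailCycle_spec hk0 (ρ F')
      have h1 := hρv F
      have h2 := hρv F'
      rw [Fin.ext_iff, hy]; simp only [hF', hF] at *; omega
    have h2 : (y * y ^ (s + 1)) (ρ F') = (y ^ (s + 1) * y) (ρ F') := by
      rw [← pow_succ', ← pow_succ]
    rw [hV, hU, ← h1]
    exact h2
  have hFU : (y ^ (2 * s)) F = U := by
    have h1 : (y ^ (s - 1)) F = ρ F := by
      rw [Fin.ext_iff, tailCycle_pow_val hk0 _ _ le_rfl, hρv]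
      · simp only [hF]; omega
      · simp only [hF]; omega
    rw [hU, hg, ← h1, ← mul_apply, ← pow_add]
    congr 2; omega
  have hyF : y F = F' := by
    have := tailCycle_spec hk0 F
    rw [Fin.ext_iff, hy]; simp only [hF', hF] at *; omega
  have hdvd : ∀ m, (y ^ m) F = F → k ∣ m := by
    intro m hm
    rw [← orderOf_tailCycle (f := f) (by omega : 2 ≤ k)]
    refine orderOf_dvd_of_pow_eq_one ((isCycle_tailCycle (by omega)).pow_eq_one_iff.2 ⟨F, ?_, hm⟩)
    change y F ≠ F
    rw [hyF, hF', hF, ne_eq, Fin.ext_iff]; simp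
  -- Oddness of `k` enters here: it excludes U = F and V = F', where y^(2s) or y^(2(s-1)) would fix
  -- F.
  have hnd : ∀ m, 0 < m → m < k → ¬ k ∣ 2 * m := by
    intro m h0 h1 h2
    have := Nat.Coprime.dvd_of_dvd_mul_left (Nat.coprime_two_right.2 hk) h2
    exact absurd (Nat.le_of_dvd h0 this) (by omega)
  have hUF : U ≠ F := fun h => hnd s (by omega) (by omega) (hdvd _ (hFU.trans h))
  have hUF' : V ≠ F' := by
    intro h
    refine hnd (s - 1) (by omega) (by omega) (hdvd _ ?_)
    have h1 : (y ^ 2) ((y ^ (2 * (s - 1))) F) = (y ^ 2) F := by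
      rw [← mul_apply, ← pow_add, show 2 + 2 * (s - 1) = 2 * s by omega, hFU, ← hyV, h, ← hyF,
        pow_two, mul_apply]
    exact (y ^ 2).injective h1
  have hne : ∀ a b : Fin (k + f), (a : ℕ) ≠ b → a ≠ b := fun a b h h' => h (congrArg Fin.val h')
  have hUo : U ≠ o ∧ V ≠ o := by
    have : g o = o := hgfix o (by simp only [ho]; omega)
    constructor <;> rw [← this] <;> refine g.injective.ne (hne _ _ ?_) <;> rw [hρv] <;>
      simp only [hF, hF', ho] <;> omega
  have hUQ : U ≠ Q ∧ V ≠ Q := by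
    rw [← hgq]
    constructor <;> refine g.injective.ne (ρ.injective.ne (hne _ _ ?_)) <;>
      simp only [hF, hF', hq] <;> omega
  -- {V, U} and {F, F'} are pairs of neighbours on the cycle `y`; by the exclusions they coincide or
  -- are disjoint.
  have hUV : swap (swap U V F) (swap U V F') = swap F F' := by
    by_cases h : U = F'
    · have hVF : V = F := y.injective (by rw [hyV, hyF, h])
      rw [h, hVF, swap_apply_left, swap_apply_right, swap_comm]
    · have hVF : V ≠ F := by
        intro h'
        exact h (by rw [← hyV, h', hyF])
      rw [swap_apply_of_ne_of_ne hUF.symm hVF.symm,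
        swap_apply_of_ne_of_ne (Ne.symm h) hUF'.symm]
  have hD : swap F F' * swap o q ∈ G := by
    rw [← hcomm]
    exact mul_mem (mul_mem (mul_mem hxG hyG) (inv_mem hxG)) (inv_mem hyG)
  set h := swap U V * swap q Q with hh
  have hval : ∀ u : Fin (k + f), (u : ℕ) ≠ k → (u : ℕ) ≠ f - 1 → h u = swap U V u := by
    intro u h1 h2
    have : swap q Q u = u := swap_apply_of_ne_of_ne (hne _ _ h1) (hne _ _ h2)
    rw [hh, mul_apply, this]
  have ho' : h o = o := by
    rw [hval o (by simp only [ho]; omega) (by simp only [ho]; omega),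
      swap_apply_of_ne_of_ne hUo.1.symm hUo.2.symm]
  have hq' : h q = Q := by
    rw [hh, mul_apply, swap_apply_left, swap_apply_of_ne_of_ne hUQ.1.symm hUQ.2.symm]
  have hFh : h F = swap U V F := hval F (by simp only [hF]; omega) (by simp only [hF]; omega)
  have hFh' : h F' = swap U V F' := hval F' (by simp only [hF']; omega) (by simp only [hF']; omega)
  have hconj : h * (swap F F' * swap o q) * h⁻¹ = swap F F' * swap o Q := by
    have : h * (swap F F' * swap o q) * h⁻¹ = swap (h F) (h F') * swap (h o) (h q) := by
      simp only [swap_apply_apply]; group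
    rw [this, hFh, hFh', hUV, ho', hq']
  have hcm : swap F F' * swap o Q = swap o Q * swap F F' := by
    rw [mul_swap_eq_swap_mul, swap_apply_of_ne_of_ne, swap_apply_of_ne_of_ne] <;>
      refine hne _ _ ?_ <;> simp only [hF, hF', ho, hQ] <;> omega
  have hfin : swap o Q * swap o q = h * (swap F F' * swap o q) * h⁻¹ * (swap F F' * swap o q) := by
    rw [hconj, hcm, mul_assoc, ← mul_assoc (swap F F'), swap_mul_self, one_mul]
  rw [hfin]
  exact mul_mem (mul_mem (mul_mem hE' hD) (inv_mem hE')) hD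

/-- For odd `k`, two cycles of length `k` that have a point in common generate a group containing
the alternating group. -/
theorem generatedByPair_of_lt_two_mul (hk : Odd k) (hf : 2 ≤ f) (hfk : f < k) :
    GeneratedByPair (k + f) k 1 := by
  have hk0 : 0 < k := by omega
  have hsign : (-1 : ℤˣ) ^ (k - 1) = 1 := Even.neg_one_pow (Nat.Odd.sub_odd hk odd_one)
  refine ⟨headCycle k f hk0, tailCycle k f hk0, orderOf_headCycle (by omega),
    orderOf_tailCycle (by omega), by rw [sign_headCycle, hsign], by rw [sign_tailCycle, hsign], ?_⟩
  have hmem : ∃ p : Fin (k + f), p ≠ ⟨0, by omega⟩ ∧ p ≠ ⟨k, by omega⟩ ∧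
      swap ⟨0, by omega⟩ p * swap ⟨0, by omega⟩ ⟨k, by omega⟩ ∈
        Subgroup.closure {headCycle k f hk0, tailCycle k f hk0} := by
    by_cases hfk' : f + 1 = k
    · refine ⟨⟨f, by omega⟩, by simp; omega, by simp; omega, ?_⟩
      rw [← commutator_of_eq (by omega) hfk']
      have hx : headCycle k f hk0 ∈ Subgroup.closure {headCycle k f hk0, tailCycle k f hk0} :=
        Subgroup.subset_closure (by simp)
      have hy : tailCycle k f hk0 ∈ Subgroup.closure {headCycle k f hk0, tailCycle k f hk0} :=
        Subgroup.subset_closure (by simp)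
      exact mul_mem (mul_mem (mul_mem hx hy) (inv_mem hx)) (inv_mem hy)
    · exact ⟨⟨f - 1, by omega⟩, by simp; omega, by simp; omega,
        swap_mul_swap_mem_closure hk hf (by omega)⟩
  obtain ⟨p, hp0, hpk, ht⟩ := hmem
  set o : Fin (k + f) := ⟨0, by omega⟩ with ho
  set q : Fin (k + f) := ⟨k, by omega⟩ with hq
  have h0k : o ≠ q := by rw [ho, hq, ne_eq, Fin.ext_iff]; simp only; omega
  have hq' : q ∈ (swap o p * swap o q).support := by
    rw [mem_support, mul_apply, swap_apply_right, swap_apply_left]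
    exact hpk
  have ho' : o ∈ (swap o p * swap o q).support := by
    rw [mem_support, mul_apply, swap_apply_left, swap_apply_of_ne_of_ne h0k.symm hpk.symm]
    exact h0k.symm
  -- `q` lies off the head cycle and `o` off the tail cycle, so each generator fixes a point of the
  -- 3-cycle.
  have hxq : headCycle k f hk0 q = q := by
    have := headCycle_spec hk0 q
    rw [Fin.ext_iff]; simp only [hq] at *; omega
  have hyo : tailCycle k f hk0 o = o := by
    have := tailCycle_spec hk0 o
    rw [Fin.ext_iff]; simp only [ho] at *; omega
  exact alternatingGroup_le_closure_pair (transitivePair_headCycle_tailCycle (by omega) hfk)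
    (isThreeCycle_swap_mul_swap_same hp0.symm h0k hpk) ht hq' (by rwa [hxq]) ho' (by rwa [hyo])

end TwoCycles

/-! ### Explicit pairs for small degrees -/

/-- All conditions are decidable; the 3-cycle is sought as a power of x^i y^j. -/
lemma generatedByPair_of_isThreeCycle {n k : ℕ} [NeZero n] {ε : ℤˣ} (x y : Perm (Fin n))
    (i j m : ℕ) (z w : Fin n) (hk : 0 < k)
    (hx : x ^ k = 1 ∧ ∀ l < k, 0 < l → x ^ l ≠ 1) (hy : y ^ k = 1 ∧ ∀ l < k, 0 < l → y ^ l ≠ 1)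
    (hsign : sign x = ε ∧ sign y = ε)
    (ht : ((x ^ i * y ^ j) ^ m).support.card = 3)
    (hmem : z ∈ ((x ^ i * y ^ j) ^ m).support ∧ x z ∈ ((x ^ i * y ^ j) ^ m).support ∧
      w ∈ ((x ^ i * y ^ j) ^ m).support ∧ y w ∈ ((x ^ i * y ^ j) ^ m).support)
    (h : ∀ u ≠ 0, ∃ v < u, x v = u ∨ y v = u ∨ x u = v ∨ y u = v) : GeneratedByPair n k ε := by
  have hxG : x ∈ Subgroup.closure {x, y} := Subgroup.subset_closure (by simp)
  have hyG : y ∈ Subgroup.closure {x, y} := Subgroup.subset_closure (by simp)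
  exact ⟨x, y, (orderOf_eq_iff hk).2 hx, (orderOf_eq_iff hk).2 hy, hsign.1, hsign.2,
    alternatingGroup_le_closure_pair (transitivePair_of_forall_exists_lt h)
      (card_support_eq_three_iff.1 ht)
      (Subgroup.pow_mem _ (mul_mem (Subgroup.pow_mem _ hxG _) (Subgroup.pow_mem _ hyG _)) _)
      hmem.1 hmem.2.1 hmem.2.2.1 hmem.2.2.2⟩

set_option maxRecDepth 20000 in
lemma generatedByPair_4_3_even : GeneratedByPair 4 3 1 :=
  generatedByPair_of_isThreeCycle (swap 1 3 * swap 3 2)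
    (swap 0 1 * swap 1 2) 1 0 1 1 1 (by norm_num) (by decide) (by decide)
    (by decide) (by decide) (by decide) (by decide)

set_option maxRecDepth 20000 in
lemma generatedByPair_6_3_even : GeneratedByPair 6 3 1 :=
  generatedByPair_of_isThreeCycle (swap 0 1 * swap 1 2 * swap 3 4 * swap 4 5)
    (swap 0 1 * swap 1 3) 0 1 1 0 0 (by norm_num) (by decide) (by decide)
    (by decide) (by decide) (by decide) (by decide)

set_option maxRecDepth 20000 in
lemma generatedByPair_8_3_even : GeneratedByPair 8 3 1 :=
  generatedByPair_of_isThreeCycle (swap 1 3 * swap 3 4 * swap 2 5 * swap 5 6)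
    (swap 0 1 * swap 1 2 * swap 4 5 * swap 5 7) 1 1 5 7 5 (by norm_num) (by decide) (by decide)
    (by decide) (by decide) (by decide) (by decide)

set_option maxRecDepth 20000 in
lemma generatedByPair_6_5_even : GeneratedByPair 6 5 1 :=
  generatedByPair_of_isThreeCycle (swap 0 1 * swap 1 4 * swap 4 5 * swap 5 3)
    (swap 0 2 * swap 2 5 * swap 5 4 * swap 4 1) 1 1 1 2 0 (by norm_num) (by decide) (by decide)
    (by decide) (by decide) (by decide) (by decide)

set_option maxRecDepth 20000 in
lemma generatedByPair_4_4_odd : GeneratedByPair 4 4 (-1) :=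
  generatedByPair_of_isThreeCycle (swap 0 1 * swap 1 2 * swap 2 3)
    (swap 0 2 * swap 2 3 * swap 3 1) 1 1 1 2 0 (by norm_num) (by decide) (by decide)
    (by decide) (by decide) (by decide) (by decide)

set_option maxRecDepth 20000 in
lemma generatedByPair_6_4_odd : GeneratedByPair 6 4 (-1) :=
  generatedByPair_of_isThreeCycle (swap 0 1 * swap 1 2 * swap 2 3)
    (swap 0 2 * swap 2 5 * swap 5 4) 2 1 2 4 2 (by norm_num) (by decide) (by decide)
    (by decide) (by decide) (by decide) (by decide)

set_option maxRecDepth 20000 in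
lemma generatedByPair_7_4_odd : GeneratedByPair 7 4 (-1) :=
  generatedByPair_of_isThreeCycle (swap 0 1 * swap 1 3 * swap 3 2)
    (swap 1 4 * swap 4 6 * swap 6 5) 2 2 2 6 2 (by norm_num) (by decide) (by decide)
    (by decide) (by decide) (by decide) (by decide)

set_option maxRecDepth 20000 in
lemma generatedByPair_8_4_odd : GeneratedByPair 8 4 (-1) :=
  generatedByPair_of_isThreeCycle (swap 0 1 * swap 2 5 * swap 5 7 * swap 7 6 * swap 3 4)
    (swap 0 2 * swap 1 3 * swap 3 7 * swap 7 4 * swap 5 6) 1 1 5 7 3 (by norm_num) (by decide) (by decide)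
    (by decide) (by decide) (by decide) (by decide)

set_option maxRecDepth 20000 in
lemma generatedByPair_6_4_even : GeneratedByPair 6 4 1 :=
  generatedByPair_of_isThreeCycle (swap 0 1 * swap 1 2 * swap 2 3 * swap 4 5)
    (swap 0 2 * swap 1 4 * swap 4 5 * swap 5 3) 2 1 1 4 1 (by norm_num) (by decide) (by decide)
    (by decide) (by decide) (by decide) (by decide)

set_option maxRecDepth 20000 in
lemma generatedByPair_10_4_even : GeneratedByPair 10 4 1 :=
  generatedByPair_of_isThreeCycle (swap 0 1 * swap 1 5 * swap 5 3 * swap 2 4 * swap 4 9 * swap 9 8)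
    (swap 0 2 * swap 2 3 * swap 3 4 * swap 1 6 * swap 6 5 * swap 5 7) 1 2 2 8 8 (by norm_num) (by decide) (by decide)
    (by decide) (by decide) (by decide) (by decide)

set_option maxRecDepth 20000 in
lemma generatedByPair_7_6_even : GeneratedByPair 7 6 1 :=
  generatedByPair_of_isThreeCycle (swap 0 1 * swap 2 5 * swap 3 6 * swap 6 4)
    (swap 0 2 * swap 1 3 * swap 3 4 * swap 5 6) 1 0 2 3 3 (by norm_num) (by decide) (by decide)
    (by decide) (by decide) (by decide) (by decide)

/-! ### Repeated attachment -/

namespace Reachable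

variable {r n s L m : ℕ} {ε : ℤˣ}

/-- A leaf is a fixed point of `b`: it uses a slot and creates none. -/
lemma attach_leaves (l : ℕ) (h : Reachable r n (s + l) L m ε) :
    Reachable r (n + l) s (L + l) m ε := by
  induction l generalizing n L with
  | zero => exact h
  | succ l ih =>
    have h1 := h.attach 0 (s := s + l)
    simp only [zero_add, Nat.lcm_one_right, pow_zero, mul_one, add_zero] at h1
    have h2 := ih h1
    rwa [add_assoc n, add_assoc L, add_comm 1 l] at h2

lemma attach_many (i q : ℕ) (hi : i + 2 ∣ m) (h : Reachable r n (s + 1) L m ε) :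
    Reachable r (n + q * (i + 2)) (s + q * i + 1) (L + q * (i + 2)) m (ε * (-1) ^ (q * (i + 1))) := by
  induction q with
  | zero => simpa using h
  | succ q ih =>
    have := ih.attach (i + 1)
    rw [show i + 1 + 1 = i + 2 from rfl, Nat.lcm_eq_left hi, mul_assoc, ← pow_add] at this
    convert this using 1 <;> ring_nf

/-- Attaching `e` transpositions and `l` fixed points. -/
lemma generatedByPair_of_attach (e l : ℕ) (h : Reachable r n (s + 1) L m ε) (hm : 2 ∣ m)
    (hl : l ≤ s + 1) (hr : r = 2 ∨ r = 3) (hL : r.Coprime (L + 2 * e + l))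
    (hn : 5 ≤ n + 2 * e + l) (hm3 : 3 ≤ m) :
    GeneratedByPair (n + 2 * e + l) m (ε * (-1) ^ e) := by
  have h1 := attach_many 0 e hm h
  simp only [zero_add, mul_zero, add_zero, mul_one, mul_comm e 2] at h1
  have h2 := attach_leaves (s := 0) l (h1.mono (by omega))
  exact h2.generatedByPair hr hL hn hm3

end Reachable

/-! ### Odd order -/

lemma coprime_two_of_odd {n : ℕ} (h : n % 2 = 1) : Nat.Coprime 2 n :=
  Nat.coprime_two_left.2 (Nat.odd_iff.2 h)

lemma coprime_three_of_mod {n : ℕ} (h : n % 3 ≠ 0) : Nat.Coprime 3 n :=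
  (Nat.Prime.coprime_iff_not_dvd Nat.prime_three).2 fun h' => h (Nat.mod_eq_zero_of_dvd h')

/-- `b` consists of `k`-cycles and fewer than `k` fixed points. With r = 2 the large cycle has
length n - 2, which suits odd `n`; for even `n` a loop makes it n - 3. -/
lemma generatedByPair_of_odd_of_two_mul_le {n k : ℕ} (hk : k % 2 = 1) (hk5 : 5 ≤ k)
    (hn : 2 * k ≤ n) : GeneratedByPair n k 1 := by
  obtain ⟨i, rfl⟩ : ∃ i, k = i + 5 := ⟨k - 5, by omega⟩
  obtain ⟨q, l, hl, rfl⟩ : ∃ q l, l < i + 5 ∧ n = (q + 2) * (i + 5) + l := by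
    refine ⟨n / (i + 5) - 2, n % (i + 5), Nat.mod_lt _ (by omega), ?_⟩
    have h1 : 2 ≤ n / (i + 5) := (Nat.le_div_iff_mul_le (by omega)).2 hn
    rw [Nat.sub_add_cancel h1, mul_comm]
    exact (Nat.div_add_mod n (i + 5)).symm
  have hpow : ∀ j, (-1 : ℤˣ) ^ (j * (i + 3 + 1)) = 1 := fun j =>
    Even.neg_one_pow (Nat.even_mul.2 (Or.inr (Nat.even_iff.2 (by omega))))
  have hpow' : (-1 : ℤˣ) ^ (i + 5 - 1) = 1 := Even.neg_one_pow (Nat.even_iff.2 (by omega))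
  have hb := reachable_base (n := i + 5) (r := 2) (Or.inl rfl) (by omega)
  rw [hpow', show i + 5 - 2 - 1 = i + 1 + 1 by omega, show i + 5 - 2 = i + 3 by omega] at hb
  have e1 : (q + 2) * (i + 5) + l = q * (i + 5) + 2 * i + 10 + l := by ring
  by_cases hodd : (q * (i + 5) + 2 * i + 10 + l) % 2 = 1
  · have h1 := Reachable.attach_many (i + 3) (q + 1) dvd_rfl hb
    rw [hpow, mul_one] at h1
    have h2 := Reachable.attach_leaves (s := 0) l (h1.mono (by nlinarith))
    convert h2.generatedByPair (Or.inl rfl) (coprime_two_of_odd ?_) ?_ (by omega) using 1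
    · ring
    · rw [show i + 3 + (q + 1) * (i + 3 + 2) + l = q * (i + 5) + 2 * i + 8 + l by ring]
      omega
    · omega
  · have h1 := hb.attachLoop (i + 2)
    rw [Nat.lcm_self, show i + 2 + 2 = 1 * (i + 3 + 1) by ring, hpow, mul_one,
      show i + 1 + (i + 2) = 2 * i + 2 + 1 by ring] at h1
    have h2 := Reachable.attach_many (i + 3) q dvd_rfl h1
    rw [hpow, mul_one] at h2
    by_cases hs : l ≤ 2 * i + 2 + q * (i + 3) + 1
    · have h3 := Reachable.attach_leaves (s := 0) l (h2.mono (by omega))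
      convert h3.generatedByPair (Or.inl rfl) (coprime_two_of_odd ?_) ?_ (by omega) using 1
      · ring
      · rw [show i + 3 + 1 * (i + 3 + 1) + q * (i + 3 + 2) + l = q * (i + 5) + 2 * i + 7 + l by ring]
        omega
      · omega
    -- Slots run short only for k = 5, n = 14, where r = 3 gives length 11.
    · have hi : i = 0 := by
        have := Nat.zero_le (q * (i + 3))
        omega
      subst hi
      obtain rfl : q = 0 := by omega
      obtain rfl : l = 4 := by omega
      have hb := reachable_base (n := 5) (r := 3) (Or.inr rfl) (by norm_num)
      have h1 := Reachable.attach_leaves (s := 0) 4 (hb.attach (s := 0) 4)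
      simpa using h1.generatedByPair (Or.inr rfl) (by norm_num) (by norm_num) (by norm_num)

/-- Here r = 3, and attached triangles keep `L` divisible by 3. One looped triangle, adding 2, or
one or two leaves correct this. The degree 8 would need two leaves on one slot. -/
lemma generatedByPair_three {n : ℕ} (hn : 4 ≤ n) : GeneratedByPair n 3 1 := by
  rcases (by omega : n = 4 ∨ n = 5 ∨ n = 6 ∨ n = 8 ∨ (n = 7 ∨ 9 ≤ n)) with
    rfl | rfl | rfl | rfl | hn
  · exact generatedByPair_4_3_even
  · exact generatedByPair_of_lt_two_mul (k := 3) (f := 2) (by decide) (by norm_num) (by norm_num)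
  · exact generatedByPair_6_3_even
  · exact generatedByPair_8_3_even
  have hpow : ∀ j, (-1 : ℤˣ) ^ (j * 2) = 1 := fun j => by rw [mul_comm, pow_mul]; simp
  by_cases h3 : n % 3 = 0
  · obtain ⟨q, rfl⟩ : ∃ q, n = 9 + 3 * q := ⟨(n - 9) / 3, by omega⟩
    have h1 := Reachable.attach_many (s := 0) 1 q dvd_rfl reachable_two_triangles
    have h2 := (h1.attachLoop 0).generatedByPair (Or.inr rfl) (coprime_three_of_mod (by omega))
      (by omega) (by simp)
    simp only [hpow, one_mul, mul_one] at h2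
    convert h2 using 1
    · ring
    · decide
    · decide
  · obtain ⟨q, l, hl, rfl⟩ : ∃ q l, l ≤ 1 + q ∧ n = 6 + 3 * q + l := by
      rcases (by omega : n % 3 = 1 ∨ n % 3 = 2) with h | h
      · exact ⟨(n - 7) / 3, 1, by omega, by omega⟩
      · exact ⟨(n - 8) / 3, 2, by omega, by omega⟩
    have h1 := Reachable.attach_many (s := 0) 1 q dvd_rfl reachable_two_triangles
    have h2 := (Reachable.attach_leaves (s := 0) l (h1.mono (by omega))).generatedByPair
      (Or.inr rfl) (coprime_three_of_mod (by omega)) (by omega) (by simp)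
    simp only [hpow, mul_one] at h2
    convert h2 using 1
    ring

theorem generatedByPair_of_odd {n k : ℕ} (hk : Odd k) (hk3 : 3 ≤ k) (hkn : k ≤ n) (hn : n ≠ 3) :
    GeneratedByPair n k 1 := by
  have hk2 := Nat.odd_iff.1 hk
  by_cases h3 : k = 3
  · subst h3
    exact generatedByPair_three (by omega)
  have hpow : (-1 : ℤˣ) ^ (k - 1) = 1 := Even.neg_one_pow (Nat.even_iff.2 (by omega))
  rcases (by omega : 2 * k ≤ n ∨ (k + 2 ≤ n ∧ n < 2 * k) ∨ n = k + 1 ∨ n = k) with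
    h | ⟨h1, h2⟩ | rfl | rfl
  · exact generatedByPair_of_odd_of_two_mul_le hk2 (by omega) h
  · obtain ⟨f, rfl⟩ : ∃ f, n = k + f := ⟨n - k, by omega⟩
    exact generatedByPair_of_lt_two_mul hk (by omega) (by omega)
  · by_cases h5 : k = 5
    · subst h5; exact generatedByPair_6_5_even
    have hb := reachable_baseLoop (n := k) (r := 2) (Or.inl rfl) (by omega)
    rw [hpow] at hb
    exact (Reachable.attach_leaves (s := 0) 1 (hb.mono (by omega))).generatedByPair (Or.inl rfl)
      (coprime_two_of_odd (by omega)) (by omega) (by omega)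
  · have hb := reachable_base (n := n) (r := 2) (Or.inl rfl) (by omega)
    rw [hpow] at hb
    exact hb.generatedByPair (Or.inl rfl) (coprime_two_of_odd (by omega)) (by omega) (by omega)

/-! ### Even order -/

/-- Two transpositions use four points and preserve the sign, so at most three leaves are needed.
The length is n - 2 for odd `l`, and n - 3 after a loop for even `l`. -/
lemma generatedByPair_of_even_of_six_le {k : ℕ} (hk : k % 2 = 0) (hk6 : 6 ≤ k) (e l : ℕ)
    (hl : l < 4) : GeneratedByPair (k + 2 * e + l) k (-1 * (-1) ^ e) := by
  have hpow : (-1 : ℤˣ) ^ (k - 1) = -1 := Odd.neg_one_pow (Nat.odd_iff.2 (by omega))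
  have h2k : 2 ∣ k := Nat.dvd_of_mod_eq_zero hk
  by_cases hlo : l % 2 = 1
  · have hb := reachable_base (n := k) (r := 2) (Or.inl rfl) (by omega)
    rw [hpow, show k - 2 - 1 = k - 4 + 1 by omega] at hb
    exact hb.generatedByPair_of_attach e l h2k (by omega) (Or.inl rfl)
      (coprime_two_of_odd (by omega)) (by omega) (by omega)
  have hb := reachable_baseLoop (n := k) (r := 2) (Or.inl rfl) (by omega)
  rw [hpow, show k - 2 - 3 = k - 6 + 1 by omega] at hb
  -- The looped 6-cycle has one slot, too few for two leaves. For e < 2, r = 3 works; for larger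
  -- `e`, two triangles replace two transpositions and both leaves without changing the sign.
  by_cases h6 : k = 6 ∧ l = 2
  · obtain ⟨rfl, rfl⟩ := h6
    by_cases he : e < 2
    · have hb := reachable_base (n := 6) (r := 3) (Or.inr rfl) (by norm_num)
      refine hb.generatedByPair_of_attach (s := 1) e 2 (by norm_num) (by norm_num) (Or.inr rfl)
        (coprime_three_of_mod (by omega)) (by omega) (by omega)
    · obtain ⟨e, rfl⟩ : ∃ e', e = e' + 2 := ⟨e - 2, by omega⟩
      have h1 := Reachable.attach_many (s := 0) 1 2 (by norm_num) hb
      have := h1.generatedByPair_of_attach e 0 (by norm_num) (by norm_num) (Or.inl rfl)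
        (coprime_two_of_odd (by omega)) (by omega) (by omega)
      convert this using 1
      · ring
      · rw [pow_add, show (-1 : ℤˣ) ^ 2 = 1 by decide,
          show (-1 : ℤˣ) ^ (2 * (1 + 1)) = 1 by decide]
        simp
  · exact hb.generatedByPair_of_attach e l h2k (by omega) (Or.inl rfl)
      (coprime_two_of_odd (by omega)) (by omega) (by omega)

/-- For k = 4 the basic configuration has a single slot. A further 4-cycle flips the sign, and a
looped one also flips the parity of `L`; this yields a suitable start for each residue of `n` modulo
4. -/
lemma neg_one_pow_two_mul (j : ℕ) : (-1 : ℤˣ) ^ (2 * j) = 1 := by rw [pow_mul]; simp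

lemma generatedByPair_four_odd {n : ℕ} (hn : 4 ≤ n) : GeneratedByPair n 4 (-1) := by
  rcases (by omega : n = 4 ∨ n = 6 ∨ n = 7 ∨ n = 8 ∨ (n = 5 ∨ 9 ≤ n)) with
    rfl | rfl | rfl | rfl | hn
  · exact generatedByPair_4_4_odd
  · exact generatedByPair_6_4_odd
  · exact generatedByPair_7_4_odd
  · exact generatedByPair_8_4_odd
  have hb : Reachable 2 4 (0 + 1) 2 4 (-1) := reachable_base (n := 4) (Or.inl rfl) (by norm_num)
  have hb2 : Reachable 2 8 (0 + 2 + 1) 6 4 1 := hb.attach 3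
  have hb3 : Reachable 2 8 (0 + 1) 5 4 1 := hb.attachLoop 1
  have hb4 : Reachable 2 12 (0 + 2 + 1) 9 4 (-1) := hb3.attach 3
  rcases (by omega : n % 4 = 1 ∨ n % 4 = 3 ∨ n % 4 = 2 ∨ n % 4 = 0) with h | h | h | h
  · obtain ⟨j, rfl⟩ : ∃ j, n = 4 + 2 * (2 * j) + 1 := ⟨(n - 5) / 4, by omega⟩
    have := hb.generatedByPair_of_attach (2 * j) 1 (by norm_num) (by norm_num) (Or.inl rfl)
      (coprime_two_of_odd (by omega)) (by omega) (by norm_num)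
    rwa [neg_one_pow_two_mul, mul_one] at this
  · obtain ⟨j, rfl⟩ : ∃ j, n = 8 + 2 * (2 * j + 1) + 1 := ⟨(n - 11) / 4, by omega⟩
    have := hb2.generatedByPair_of_attach (2 * j + 1) 1 (by norm_num) (by norm_num) (Or.inl rfl)
      (coprime_two_of_odd (by omega)) (by omega) (by norm_num)
    rwa [pow_succ, neg_one_pow_two_mul, one_mul, one_mul] at this
  · obtain ⟨j, rfl⟩ : ∃ j, n = 8 + 2 * (2 * j + 1) + 0 := ⟨(n - 10) / 4, by omega⟩
    have := hb3.generatedByPair_of_attach (2 * j + 1) 0 (by norm_num) (by norm_num) (Or.inl rfl)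
      (coprime_two_of_odd (by omega)) (by omega) (by norm_num)
    rwa [pow_succ, neg_one_pow_two_mul, one_mul, one_mul] at this
  · obtain ⟨j, rfl⟩ : ∃ j, n = 12 + 2 * (2 * j) + 0 := ⟨(n - 12) / 4, by omega⟩
    have := hb4.generatedByPair_of_attach (2 * j) 0 (by norm_num) (by norm_num) (Or.inl rfl)
      (coprime_two_of_odd (by omega)) (by omega) (by norm_num)
    rwa [neg_one_pow_two_mul, mul_one] at this

lemma generatedByPair_four_even {n : ℕ} (hn : 6 ≤ n) : GeneratedByPair n 4 1 := by
  rcases (by omega : n = 6 ∨ n = 10 ∨ (n ≠ 6 ∧ n ≠ 10)) with rfl | rfl | ⟨h6, h10⟩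
  · exact generatedByPair_6_4_even
  · exact generatedByPair_10_4_even
  have hb : Reachable 2 4 (0 + 1) 2 4 (-1) := reachable_base (n := 4) (Or.inl rfl) (by norm_num)
  have hb2 : Reachable 2 8 (0 + 2 + 1) 6 4 1 := hb.attach 3
  have hb3 : Reachable 2 8 (0 + 1) 5 4 1 := hb.attachLoop 1
  have hb4 : Reachable 2 12 (0 + 2 + 1) 9 4 (-1) := hb3.attach 3
  rcases (by omega : n % 4 = 3 ∨ n % 4 = 1 ∨ n % 4 = 0 ∨ n % 4 = 2) with h | h | h | h
  · obtain ⟨j, rfl⟩ : ∃ j, n = 4 + 2 * (2 * j + 1) + 1 := ⟨(n - 7) / 4, by omega⟩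
    have := hb.generatedByPair_of_attach (2 * j + 1) 1 (by norm_num) (by norm_num) (Or.inl rfl)
      (coprime_two_of_odd (by omega)) (by omega) (by norm_num)
    simpa [pow_succ, neg_one_pow_two_mul] using this
  · obtain ⟨j, rfl⟩ : ∃ j, n = 8 + 2 * (2 * j) + 1 := ⟨(n - 9) / 4, by omega⟩
    have := hb2.generatedByPair_of_attach (2 * j) 1 (by norm_num) (by norm_num) (Or.inl rfl)
      (coprime_two_of_odd (by omega)) (by omega) (by norm_num)
    rwa [neg_one_pow_two_mul, mul_one] at this
  · obtain ⟨j, rfl⟩ : ∃ j, n = 8 + 2 * (2 * j) + 0 := ⟨(n - 8) / 4, by omega⟩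
    have := hb3.generatedByPair_of_attach (2 * j) 0 (by norm_num) (by norm_num) (Or.inl rfl)
      (coprime_two_of_odd (by omega)) (by omega) (by norm_num)
    rwa [neg_one_pow_two_mul, mul_one] at this
  · obtain ⟨j, rfl⟩ : ∃ j, n = 12 + 2 * (2 * j + 1) + 0 := ⟨(n - 14) / 4, by omega⟩
    have := hb4.generatedByPair_of_attach (2 * j + 1) 0 (by norm_num) (by norm_num) (Or.inl rfl)
      (coprime_two_of_odd (by omega)) (by omega) (by norm_num)
    simpa [pow_succ, neg_one_pow_two_mul] using this

theorem generatedByPair_of_even_odd {n k : ℕ} (hk : k % 2 = 0) (hk3 : 3 ≤ k) (hkn : k ≤ n) :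
    GeneratedByPair n k (-1) := by
  by_cases h4 : k = 4
  · subst h4; exact generatedByPair_four_odd hkn
  obtain ⟨j, l, hl, rfl⟩ : ∃ j l, l < 4 ∧ n = k + 2 * (2 * j) + l :=
    ⟨(n - k) / 4, (n - k) % 4, by omega, by omega⟩
  have := generatedByPair_of_even_of_six_le hk (by omega) (2 * j) l hl
  rwa [neg_one_pow_two_mul, mul_one] at this

/-- Even permutations of order `k = 2m`, `m` odd, on `k` or `k + 1` points. -/
lemma generatedByPair_two_mul {n m : ℕ} (hm : m % 2 = 1) (hm5 : 5 ≤ m)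
    (hn : n = 2 * m ∨ n = 2 * m + 1) : GeneratedByPair n (2 * m) 1 := by
  have hpow : (-1 : ℤˣ) ^ (m - 1) = 1 := Even.neg_one_pow (Nat.even_iff.2 (by omega))
  have hlcm : Nat.lcm m (1 + 1) = 2 * m := by
    rw [Nat.Coprime.lcm_eq_mul (Nat.coprime_two_right.2 (Nat.odd_iff.2 hm)), mul_comm]
  -- An `m`-cycle with 2j + 2 transpositions is even of order 2m.
  have key : ∀ r s L, Reachable r m (s + 1) L m 1 → (r = 2 ∨ r = 3) → ∀ j l, l ≤ s + 1 →
      r.Coprime (L + 2 + 2 * (2 * j + 1) + l) →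
      GeneratedByPair (m + 4 + 4 * j + l) (2 * m) 1 := by
    intro r s L h hr j l hl hL
    have h1 := h.attach 1
    rw [hlcm] at h1
    have := h1.generatedByPair_of_attach (2 * j + 1) l (by omega) hl hr hL (by omega) (by omega)
    rw [pow_one, pow_succ (-1 : ℤˣ) (2 * j), neg_one_pow_two_mul] at this
    convert this using 1
    · ring
    · decide
  rcases hn with rfl | rfl
  · by_cases h9 : 9 ≤ m
    · have hb := reachable_baseLoop (n := m) (r := 2) (Or.inl rfl) (by omega)
      rw [hpow, show m - 2 - 3 = m - 6 + 1 by omega] at hb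
      have := key _ _ _ hb (Or.inl rfl) ((m - 4) / 4) ((m - 4) % 4) (by omega)
        (coprime_two_of_odd (by omega))
      convert this using 1; omega
    -- The looped cycle has too few slots here, so r = 3 is used.
    · rcases (by omega : m = 5 ∨ m = 7) with rfl | rfl
      · have hb : Reachable 3 5 (0 + 1) 2 5 1 := reachable_base (Or.inr rfl) (by norm_num)
        exact key _ _ _ hb (Or.inr rfl) 0 1 (by norm_num) (by norm_num)
      · have hb : Reachable 3 7 (2 + 1) 4 7 1 := reachable_base (Or.inr rfl) (by norm_num)
        exact key _ _ _ hb (Or.inr rfl) 0 3 (by norm_num) (by norm_num)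
  · have hb := reachable_base (n := m) (r := 2) (Or.inl rfl) (by omega)
    rw [hpow, show m - 2 - 1 = m - 4 + 1 by omega] at hb
    have := key _ _ _ hb (Or.inl rfl) ((m - 3) / 4) ((m - 3) % 4) (by omega)
      (coprime_two_of_odd (by omega))
    convert this using 1; omega

/-- Even permutations of order `k = 2h`, `4 ∣ k`, on `k` or `k + 1` points. -/
lemma generatedByPair_two_pow_mul {n a m : ℕ} (hm : Odd m) (hm3 : 3 ≤ m)
    (hn : n = 2 ^ (a + 2) * m ∨ n = 2 ^ (a + 2) * m + 1) :
    GeneratedByPair n (2 ^ (a + 2) * m) 1 := by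
  obtain ⟨c, hc⟩ : ∃ c, 2 ^ (a + 2) = c + 4 := ⟨2 ^ (a + 2) - 4, by
    have : 2 ^ 2 ≤ 2 ^ (a + 2) := Nat.pow_le_pow_right (by norm_num) (by omega)
    omega⟩
  have hc2 : c % 2 = 0 := by
    have : 2 ∣ 2 ^ (a + 2) := dvd_pow_self 2 (by omega)
    omega
  obtain ⟨h, hh⟩ : ∃ h, 2 ^ (a + 1) * m = h := ⟨_, rfl⟩
  have hk : 2 ^ (a + 2) * m = 2 * h := by rw [← hh]; ring
  -- An `h`-cycle together with a 2^(a+2)-cycle has order 2h and is even, both lengths being even.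
  -- They fit into 2h points because m ≥ 3.
  have hlcm : Nat.lcm h (c + 3 + 1) = 2 * h := by
    rw [show c + 3 + 1 = c + 4 from rfl, ← hc, ← hh, show a + 2 = (a + 1) + 1 from rfl,
      pow_succ 2 (a + 1), Nat.lcm_mul_left,
      Nat.Coprime.lcm_eq_mul (Nat.coprime_two_right.2 hm)]
    ring
  have hge : 3 * (c + 4) ≤ 2 * h := by rw [← hk, hc, mul_comm 3]; exact Nat.mul_le_mul_left _ hm3
  have hev : h % 2 = 0 := by
    rw [← hh, pow_succ, mul_assoc, mul_left_comm]; omega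
  have hpow : (-1 : ℤˣ) ^ (h - 1) = -1 := Odd.neg_one_pow (Nat.odd_iff.2 (by omega))
  have hpow' : (-1 : ℤˣ) * (-1 : ℤˣ) ^ (c + 3) = 1 := by
    rw [Odd.neg_one_pow (Nat.odd_iff.2 (by omega))]; rfl
  rw [hk] at hn ⊢
  have key : ∀ s L, Reachable 2 h (s + 1) L h (-1) → ∀ j l, l ≤ 3 →
      Nat.Coprime 2 (L + (c + 3 + 1) + 2 * (2 * j) + l) →
      GeneratedByPair (h + (c + 4) + 4 * j + l) (2 * h) 1 := by
    intro s L h' j l hl hL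
    have h1 := h'.attach (c + 3)
    rw [hlcm, hpow', show s + (c + 3) = s + c + 2 + 1 from rfl] at h1
    have := h1.generatedByPair_of_attach (2 * j) l (by omega) (by omega) (Or.inl rfl) hL (by omega)
      (by omega)
    rw [neg_one_pow_two_mul, mul_one] at this
    convert this using 1
    ring
  rcases hn with rfl | rfl
  · have hb := reachable_baseLoop (n := h) (r := 2) (Or.inl rfl) (by omega)
    rw [hpow, show h - 2 - 3 = h - 6 + 1 by omega] at hb
    have := key _ _ hb ((h - (c + 4)) / 4) ((h - (c + 4)) % 4) (by omega)
      (coprime_two_of_odd (by omega))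
    convert this using 1; omega
  · have hb := reachable_base (n := h) (r := 2) (Or.inl rfl) (by omega)
    rw [hpow, show h - 2 - 1 = h - 4 + 1 by omega] at hb
    have := key _ _ hb ((h - (c + 4) + 1) / 4) ((h - (c + 4) + 1) % 4) (by omega)
      (coprime_two_of_odd (by omega))
    convert this using 1; omega

theorem generatedByPair_of_even_even {n k : ℕ} (hk : k % 2 = 0) (hk3 : 3 ≤ k) (hkn : k ≤ n)
    (hne : ¬ IsExceptional n k) : GeneratedByPair n k 1 := by
  simp only [IsExceptional, not_or, not_and] at hne
  by_cases hn : k + 2 ≤ n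
  · by_cases h4 : k = 4
    · subst h4; exact generatedByPair_four_even hn
    obtain ⟨j, l, hl, rfl⟩ : ∃ j l, l < 4 ∧ n = k + 2 * (2 * j + 1) + l :=
      ⟨(n - k - 2) / 4, (n - k - 2) % 4, by omega, by omega⟩
    have := generatedByPair_of_even_of_six_le hk (by omega) (2 * j + 1) l hl
    simpa [pow_succ, neg_one_pow_two_mul] using this
  have hpow := hne.1 (by omega)
  obtain ⟨a, m, hm, rfl⟩ := Nat.exists_eq_two_pow_mul_odd (n := k) (by omega)
  have hm' := Nat.odd_iff.1 hm
  have hm1 : m ≠ 1 := by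
    rintro rfl
    exact hpow ⟨a, by simp⟩
  rcases a with _ | _ | a
  · omega
  · rw [zero_add, pow_one] at *
    by_cases h3 : m = 3
    · subst h3
      obtain rfl : n = 7 := by omega
      exact generatedByPair_7_6_even
    · exact generatedByPair_two_mul hm' (by omega) (by omega)
  · have h1 : ¬ 2 ^ (a + 2) * m + 2 ≤ n := hn
    have h2 : 2 ^ (a + 2) * m ≤ n := hkn
    exact generatedByPair_two_pow_mul hm (by omega) (by omega)

/-! ### Minimal ranks and the exceptional cases -/

section OrderRank

lemma hasOrderRank_two {G : Type*} [Group G] {k : ℕ} (hG : ¬ IsMulCommutative G) {x y : G}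
    (hx : orderOf x = k) (hy : orderOf y = k) (h : Subgroup.closure {x, y} = ⊤) :
    HasOrderRank k G 2 := by
  classical
  have key : ∀ g : G, Subgroup.closure {g} ≠ ⊤ := fun g hg ↦ hG <| by
    have : IsCyclic G := ⟨g, (Subgroup.eq_top_iff' (Subgroup.zpowers g)).1 (by
      rw [Subgroup.zpowers_eq_closure, hg])⟩
    exact IsCyclic.isMulCommutative
  have hxy : x ≠ y := by
    rintro rfl
    exact key x (by simpa using h)
  refine ⟨⟨{x, y}, Finset.card_pair hxy, by simp [hx, hy], by simpa using h⟩, ?_⟩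
  rintro m ⟨s, rfl, -, hs⟩
  by_contra! hlt
  obtain ⟨g, hg⟩ := Finset.card_le_one_iff_subset_singleton.1 (Nat.lt_succ_iff.1 hlt)
  refine key g (top_le_iff.1 (hs ▸ Subgroup.closure_mono ?_))
  exact_mod_cast hg

variable {n k : ℕ}

lemma closure_eq_top_of_alternatingGroup_le {H : Subgroup (Perm (Fin n))} {x : Perm (Fin n)}
    (hH : alternatingGroup (Fin n) ≤ H) (hx : x ∈ H) (hs : sign x = -1) : H = ⊤ := by
  refine top_le_iff.1 fun g _ ↦ ?_
  rcases Int.units_eq_one_or (sign g) with hg | hg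
  · exact hH (mem_alternatingGroup.2 hg)
  · have : g * x ∈ H := hH (mem_alternatingGroup.2 (by simp [hg, hs]))
    exact (Subgroup.mul_mem_cancel_right H hx).1 this

lemma not_isMulCommutative_perm (hn : 3 ≤ n) : ¬ IsMulCommutative (Perm (Fin n)) := by
  intro h
  have h1 := h.is_comm.comm (swap (⟨0, by omega⟩ : Fin n) ⟨1, by omega⟩)
    (swap (⟨1, by omega⟩ : Fin n) ⟨2, by omega⟩)
  have := congrArg (fun f : Perm (Fin n) ↦ (f ⟨2, by omega⟩).val) h1
  simp [swap_apply_def] at this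

lemma GeneratedByPair.hasOrderRank_perm (hn : 3 ≤ n) (h : GeneratedByPair n k (-1)) :
    HasOrderRank k (Perm (Fin n)) 2 := by
  obtain ⟨x, y, hx, hy, hsx, -, hle⟩ := h
  exact hasOrderRank_two (not_isMulCommutative_perm hn) hx hy
    (closure_eq_top_of_alternatingGroup_le hle (Subgroup.subset_closure (by simp)) hsx)

lemma GeneratedByPair.hasOrderRank_alternatingGroup (hn : 4 ≤ n) (h : GeneratedByPair n k 1) :
    HasOrderRank k (alternatingGroup (Fin n)) 2 := by
  obtain ⟨x, y, hx, hy, hsx, hsy, hle⟩ := h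
  have hG : ¬ IsMulCommutative (alternatingGroup (Fin n)) := by
    rw [alternatingGroup.isMulCommutative_iff_card_le_three, Nat.card_fin]
    omega
  refine hasOrderRank_two hG (x := ⟨x, mem_alternatingGroup.2 hsx⟩)
    (y := ⟨y, mem_alternatingGroup.2 hsy⟩) (by rwa [Subgroup.orderOf_mk])
    (by rwa [Subgroup.orderOf_mk]) ?_
  refine Subgroup.map_injective (alternatingGroup (Fin n)).subtype_injective ?_
  rw [MonoidHom.map_closure, ← MonoidHom.range_eq_map, Subgroup.range_subtype, Set.image_pair]
  refine le_antisymm ?_ hle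
  rw [Subgroup.closure_le]
  rintro g (rfl | rfl)
  exacts [mem_alternatingGroup.2 hsx, mem_alternatingGroup.2 hsy]

lemma hasOrderRank_alternatingGroup_three :
    HasOrderRank 3 (alternatingGroup (Fin 3)) 1 := by
  have hcard : Nat.card (alternatingGroup (Fin 3)) = 3 := by
    rw [nat_card_alternatingGroup, Nat.card_fin]; rfl
  have : Fact (Nat.Prime 3) := ⟨Nat.prime_three⟩
  have hcyc : IsCyclic (alternatingGroup (Fin 3)) := isCyclic_of_prime_card hcard
  obtain ⟨g, hg⟩ := hcyc.exists_generator
  refine ⟨⟨{g}, rfl, ?_, ?_⟩, ?_⟩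
  · simp [← hcard, orderOf_eq_card_of_forall_mem_zpowers hg]
  · rw [Finset.coe_singleton, ← Subgroup.zpowers_eq_closure]
    exact (Subgroup.eq_top_iff' _).2 hg
  · rintro m ⟨s, rfl, -, hs⟩
    rw [Nat.one_le_iff_ne_zero, Ne, Finset.card_eq_zero]
    rintro rfl
    rw [Finset.coe_empty, Subgroup.closure_empty] at hs
    rw [← Subgroup.card_top, ← hs, Subgroup.card_bot] at hcard
    omega

/-- The divisors of a prime power form a chain, so the lcm of finitely many is the largest of them;
m > 0 excludes the empty multiset. -/
lemma prime_pow_mem_of_lcm_eq {p m : ℕ} (hp : p.Prime) (hm : 0 < m) {s : Multiset ℕ}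
    (h : s.lcm = p ^ m) : p ^ m ∈ s := by
  induction s using Multiset.induction with
  | empty =>
    rw [Multiset.lcm_zero] at h
    exact absurd h.symm (Nat.one_lt_pow hm.ne' hp.one_lt).ne'
  | cons a s ih =>
    rw [Multiset.lcm_cons] at h
    obtain ⟨i, hi, rfl⟩ := (Nat.dvd_prime_pow hp).1 (h ▸ dvd_lcm_left a s.lcm)
    obtain ⟨j, hj, hs⟩ := (Nat.dvd_prime_pow hp).1 (h ▸ dvd_lcm_right (p ^ i) s.lcm)
    rw [hs] at h ih
    rcases le_total i j with hij | hij
    · have hd : lcm (p ^ i) (p ^ j) = p ^ j :=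
        Nat.lcm_eq_right (pow_dvd_pow p hij)
      exact Multiset.mem_cons_of_mem (ih (by rw [← h, hd]))
    · have hd : lcm (p ^ i) (p ^ j) = p ^ i :=
        Nat.lcm_eq_left (pow_dvd_pow p hij)
      rw [← h, hd]
      exact Multiset.mem_cons_self _ _

/-- At most one point remains, and a nontrivial cycle needs two. -/
lemma eq_zero_of_cycleType_eq_add {g : Perm (Fin n)} {s t : Multiset ℕ}
    (h : g.cycleType = s + t) (hs : n ≤ s.sum + 1) : t = 0 := by
  have hsum := sum_cycleType g
  have hle := Finset.card_le_univ g.support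
  rw [Fintype.card_fin] at hle
  rw [h, Multiset.sum_add] at hsum
  refine Multiset.eq_zero_of_forall_notMem fun a ha ↦ ?_
  have h2 : 2 ≤ a := two_le_of_mem_cycleType (h ▸ Multiset.mem_add.2 (Or.inr ha))
  have := Multiset.le_sum_of_mem ha
  omega

lemma sign_of_orderOf_eq_two_pow {m : ℕ} {g : Perm (Fin n)} (hm : 0 < m) (hg : orderOf g = 2 ^ m)
    (hn : n ≤ 2 ^ m + 1) : sign g = -1 := by
  have hmem := prime_pow_mem_of_lcm_eq Nat.prime_two hm ((lcm_cycleType g).trans hg)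
  obtain ⟨t, ht⟩ := Multiset.le_iff_exists_add.1 (Multiset.singleton_le.2 hmem)
  rw [sign_of_cycleType, ht, eq_zero_of_cycleType_eq_add ht (by simpa using hn)]
  obtain ⟨m, rfl⟩ := Nat.exists_eq_succ_of_ne_zero hm.ne'
  simp [pow_succ, pow_mul]

lemma sign_of_orderOf_eq_six {g : Perm (Fin 6)} (hg : orderOf g = 6) : sign g = -1 := by
  have hlcm := (lcm_cycleType g).trans hg
  have hpart : ∀ a ∈ g.cycleType, a = 2 ∨ a = 3 ∨ a = 6 := fun a ha ↦ by
    have h2 := two_le_of_mem_cycleType ha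
    have hd : a ∣ 6 := hlcm ▸ Multiset.dvd_lcm ha
    have := Nat.le_of_dvd (by norm_num) hd
    interval_cases a <;> omega
  -- Either a 6-cycle, or cycles of lengths 2 and 3 with one fixed point; both types are odd.
  by_cases h6 : 6 ∈ g.cycleType
  · obtain ⟨t, ht⟩ := Multiset.le_iff_exists_add.1 (Multiset.singleton_le.2 h6)
    rw [sign_of_cycleType, ht, eq_zero_of_cycleType_eq_add ht (by simp)]
    decide
  · have h2 : 2 ∈ g.cycleType := by
      by_contra h2
      have : g.cycleType.lcm ∣ 3 := Multiset.lcm_dvd.2 fun a ha ↦ by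
        rcases hpart a ha with rfl | rfl | rfl
        exacts [absurd ha h2, dvd_rfl, absurd ha h6]
      rw [hlcm] at this
      omega
    have h3 : 3 ∈ g.cycleType := by
      by_contra h3
      have : g.cycleType.lcm ∣ 2 := Multiset.lcm_dvd.2 fun a ha ↦ by
        rcases hpart a ha with rfl | rfl | rfl
        exacts [dvd_rfl, absurd ha h3, absurd ha h6]
      rw [hlcm] at this
      omega
    have hle : ({2, 3} : Multiset ℕ) ≤ g.cycleType :=
      (Multiset.le_iff_subset (by decide)).2 (by simp [Multiset.cons_subset, h2, h3])
    obtain ⟨t, ht⟩ := Multiset.le_iff_exists_add.1 hle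
    rw [sign_of_cycleType, ht, eq_zero_of_cycleType_eq_add ht (by simp)]
    decide

lemma closure_orderOf_ne_top (hk : 3 ≤ k) (hkn : k ≤ n) (h : IsExceptional n k) :
    Subgroup.closure {g : alternatingGroup (Fin n) | orderOf g = k} ≠ ⊤ := by
  have hempty : {g : alternatingGroup (Fin n) | orderOf g = k} = ∅ := by
    refine Set.eq_empty_of_forall_notMem fun g hg ↦ ?_
    have h1 : sign (g : Perm (Fin n)) = 1 := mem_alternatingGroup.1 g.2
    rw [Set.mem_ofPred_eq, ← Subgroup.orderOf_coe] at hg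
    have h2 : sign (g : Perm (Fin n)) = -1 := by
      rcases h with ⟨hn, m, rfl⟩ | ⟨rfl, rfl⟩
      · refine sign_of_orderOf_eq_two_pow (Nat.pos_of_ne_zero ?_) hg (by omega)
        rintro rfl
        norm_num at hk
      · exact sign_of_orderOf_eq_six hg
    rw [h1] at h2
    exact absurd h2 (by decide)
  rw [hempty, Subgroup.closure_empty]
  have : Nontrivial (alternatingGroup (Fin n)) :=
    alternatingGroup.nontrivial_of_three_le_card (by rw [Nat.card_fin]; omega)
  exact bot_ne_top

end OrderRank

end

theorem theorem1 (n k : ℕ) (hk : 3 ≤ k) (hkn : k ≤ n) :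
    (Even k →
      HasOrderRank k (Equiv.Perm (Fin n)) 2 ∧
      (¬ IsExceptional n k → HasOrderRank k (alternatingGroup (Fin n)) 2) ∧
      (IsExceptional n k →
        Subgroup.closure {g : alternatingGroup (Fin n) | orderOf g = k} ≠ ⊤)) ∧
    (Odd k →
      (n ≠ 3 → HasOrderRank k (alternatingGroup (Fin n)) 2) ∧
      (n = 3 → HasOrderRank k (alternatingGroup (Fin n)) 1)) := by
  refine ⟨fun he ↦ ?_, fun ho ↦ ⟨fun hn ↦ ?_, fun hn ↦ ?_⟩⟩
  · have hmod := Nat.even_iff.1 he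
    exact ⟨(generatedByPair_of_even_odd hmod hk hkn).hasOrderRank_perm (by omega),
      fun hne ↦ (generatedByPair_of_even_even hmod hk hkn hne).hasOrderRank_alternatingGroup
        (by omega), closure_orderOf_ne_top hk hkn⟩
  · exact (generatedByPair_of_odd ho hk hkn hn).hasOrderRank_alternatingGroup (by omega)
  · obtain rfl : k = 3 := by omega
    subst hn
    exact hasOrderRank_alternatingGroup_three
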